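/- Let $\mathcal M$ be a rational $G^1$ polygonal surface made up of rectangles and triangles. That is, $\mathcal M$ consists of the following data. * A finite nonempty collection of non-degenerate triangles and rectangles in $\mathbb R^2$, and a finite collection of affine-linear homeomorphisms $\lambda:\tau_1\to\tau_2$ between pairs of polygonal edges. Each polygonal edge is glued to at most one other edge and never to itself, and the resulting surface is connected. The glued pairs $\mathcal E=\tau_1\sim\tau_2$ are the interior edges, the remaining polygonal edges are the boundary edges. The vertices of $\mathcal M$ are the classes of identified polygonal vertices. A vertex is a boundary vertex if it lies on a boundary edge, and an interior vertex otherwise. * For each interior edge, polynomials $a,b,c\in\mathbb R[u]$ without a common factor such that $\beta=b/a$, $\gamma=c/a$ have no poles on $[0,1]$ and $\gamma<0$ on $[0,1]$. They identify the tangent spaces along the edge by $\partial/\partial u_1=\partial/\partial u_2$ and $\partial/\partial v_1=\beta(u_1)\,\partial/\partial u_2+\gamma(u_1)\,\partial/\partial v_2$. Here $(u_i,v_i)$ are standard coordinates attached to $\tau_i$, with $u_1=0$ and $u_2=0$ at identified end-points: $P+u\,(Q-P)+v\,(R-P)$ is the point with coordinates $(u,v)$, where $PQ$ is the edge and $PR$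 is the other edge of the polygon at $P$. Around a vertex let $P_1,\dots,P_n$ be the identified polygonal corners in consecutive order, where the edge $\tau_k$ at $P_k$ is glued to the edge $\tau'_{k-1}$ at $P_{k-1}$ (with $P_0=P_n$, $\tau'_0=\tau'_n$ at an interior vertex; at a boundary vertex, $\tau_1$ and $\tau'_n$ are boundary edges). Let $\beta_k,\gamma_k$ be the gluing functions of $\tau_k\sim\tau'_{k-1}$ in the standard coordinates with $u=0$ at $P_k$, $P_{k-1}$, and let $T_k=\begin{pmatrix}0&1\\ \gamma_k(0)&\beta_k(0)\end{pmatrix}$. The edge is joining at the vertex if $\beta_k(0)=0$. A crossing vertex is an interior vertex with $n=4$ at which all four edges are joining. The following is required. * At each interior vertex, $T_n\cdots T_1$ is the identity matrix, and each partial product $T_k\cdots T_1$ with $1\le k<n$ has a non-positive entry in each row and on the main diagonal. * At each crossing vertex, $$\beta_1'(0)+\frac{\gamma_2'(0)}{\gamma_2(0)}=-\gamma_1(0)\Big(\beta_3'(0)+\frac{\gamma_4'(0)}{\gamma_4(0)}\Big),\qquad \beta_2'(0)+\frac{\gamma_3'(0)}{\gamma_3(0)}=-\gamma_2(0)\Big(\beta_4'(0)+\frac{\gamma_1'(0)}{\gamma_1(0)}\Big).$$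 * At each boundary vertex, each product $T_k\cdots T_2$ with $2\le k\le n$ has a non-positive entry in each row and on the main diagonal, and the bottom row of the product with $k=n$ is not $(1\ 0)$. For an interior edge $\mathcal E=\tau_1\sim\tau_2$ let $r_i=1$ if $\tau_i$ is an edge of a rectangle, let $r_i=0$ if it is an edge of a triangle, and let $$\delta(\mathcal E)=\max(r_1+\deg a,\ \deg b,\ r_2+\deg c).$$ Let $\delta(\mathcal M)$ be the sum of $\delta(\mathcal E)$ over all interior edges. Let $N_\Box,N_\Delta,N_0,N_0^+,N_1^\partial$ be the numbers of rectangles, triangles, vertices, crossing vertices and boundary edges of $\mathcal M$, respectively. Let $S^1_k(\mathcal M)$ be the space of families of polynomial functions $g$, one on each polygon, of degree $\le k$ on the triangles and of bidegree $\le(k,k)$ (in coordinates along the sides) on the rectangles, such that on each interior edge $$g_1=g_2,\qquad \frac{\partial g_1}{\partial v_1}=\beta\,\frac{\partial g_2}{\partial u_2}+\gamma\,\frac{\partial g_2}{\partial v_2}$$ at identified points. **Lemma.** For every integer $k\ge 2$, the space $S^1_k(\mathcal M)$ is finite-dimensional and $$\dim S^1_k(\mathcal M)\ \ge\ 3N_0+N_0^+-\delta(\mathcal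 M)+\Big(k-\frac52\Big)N_1^\partial+(k^2-2k-1)\,N_\Box+\frac{k^2-3k-1}{2}\,N_\Delta .$$ -/

import Mathlib

open scoped Polynomial

noncomputable section

namespace G1Spline

/-! ## Triangles and rectangles in the plane -/

/-- The Euclidean plane. -/
abbrev Plane : Type := EuclideanSpace ℝ (Fin 2)

inductive Shape : Type
  | triangle
  | rectangle

def Shape.sides : Shape → ℕ
  | .triangle => 3
  | .rectangle => 4

instance (s : Shape) : NeZero s.sides := ⟨by cases s <;> decide⟩

/-- `1` for a rectangle and `0` for a triangle. -/
def Shape.r : Shape → ℕ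
  | .triangle => 0
  | .rectangle => 1

/-- A non-degenerate triangle, or a rectangle, with cyclically ordered vertices.
A quadrilateral is a rectangle when its four angles are right. Arithmetic of vertex
indices is modulo the number of sides. -/
structure Polygon : Type where
  shape : Shape
  vert : Fin shape.sides → Plane
  nondegenerate : ∀ i, LinearIndependent ℝ ![vert (i + 1) - vert i, vert (i - 1) - vert i]
  right_angles : shape = Shape.rectangle →
    ∀ i, inner ℝ (vert (i + 1) - vert i) (vert (i - 1) - vert i) = 0

/-! ## Polynomial gluing data -/

/-- The polynomials `a, b, c` that express the gluing functions `β = b / a` and `γ = c / a`. -/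
structure GluingPoly : Type where
  a : ℝ[X]
  b : ℝ[X]
  c : ℝ[X]

namespace GluingPoly

/-- The function `β = b / a`. -/
def beta (D : GluingPoly) (u : ℝ) : ℝ := D.b.eval u / D.a.eval u

/-- The function `γ = c / a`. -/
def gamma (D : GluingPoly) (u : ℝ) : ℝ := D.c.eval u / D.a.eval u

/-- The same gluing, read from the second polygon to the first one: the relation
`a ∂/∂v₁ = b ∂/∂u₂ + c ∂/∂v₂` is rewritten as `c ∂/∂v₂ = - b ∂/∂u₁ + a ∂/∂v₁`. -/
def swap (D : GluingPoly) : GluingPoly := ⟨D.c, -D.b, D.a⟩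

/-- The same gluing in the standard coordinates that start at the other end-point of the edge.
On a triangle they are `(1 - u - v, v)`, on a rectangle `(1 - u, v)`. The arguments `s₁, s₂` are
the shapes of the two polygons. -/
def reverse (s₁ s₂ : Shape) (D : GluingPoly) : GluingPoly :=
  ⟨D.a.comp (1 - Polynomial.X),
   (Polynomial.C (1 - (s₁.r : ℝ)) * D.a - Polynomial.C (1 - (s₂.r : ℝ)) * D.c - D.b).comp
      (1 - Polynomial.X),
   D.c.comp (1 - Polynomial.X)⟩

/-- The matrix that expresses `(∂/∂u_k, ∂/∂v_k)` through `(∂/∂u_{k-1}, ∂/∂v_{k-1})` at the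
common vertex, where `D` glues the edge `v_k = 0` to the edge `u_{k-1} = 0`. -/
def tangentMatrix (D : GluingPoly) : Matrix (Fin 2) (Fin 2) ℝ :=
  !![0, 1; D.gamma 0, D.beta 0]

end GluingPoly

/-- The partial product `T_k ⋯ T_2 T_1` of the tangent matrices `T_j` of `D j`. -/
def tangentProd (D : ℕ → GluingPoly) : ℕ → Matrix (Fin 2) (Fin 2) ℝ
  | 0 => 1
  | k + 1 => (D (k + 1)).tangentMatrix * tangentProd D k

/-- Each row and the main diagonal have a non-positive entry. -/
def NoOverlap (T : Matrix (Fin 2) (Fin 2) ℝ) : Prop :=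
  (T 0 0 ≤ 0 ∨ T 0 1 ≤ 0) ∧ (T 1 0 ≤ 0 ∨ T 1 1 ≤ 0) ∧ (T 0 0 ≤ 0 ∨ T 1 1 ≤ 0)

/-! ## Flags: polygonal vertices with an incident polygonal edge -/

/-- A vertex of one of the polygons, together with one of the two edges at it: the edge to the
next vertex (`forward = true`) or to the previous one. -/
structure Flag {K₀ : Type*} (Ω : K₀ → Polygon) where
  face : K₀
  idx : Fin (Ω face).shape.sides
  forward : Bool

/-- A vertex of one of the polygons. -/
abbrev Corner {K₀ : Type*} (Ω : K₀ → Polygon) := Σ x : K₀, Fin (Ω x).shape.sides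

/-- An edge of one of the polygons: `⟨x, i⟩` joins the vertices `i` and `i + 1` of `Ω x`. -/
abbrev PolyEdge {K₀ : Type*} (Ω : K₀ → Polygon) := Σ x : K₀, Fin (Ω x).shape.sides

namespace Flag

variable {K₀ : Type*} {Ω : K₀ → Polygon}

def shape (f : Flag Ω) : Shape := (Ω f.face).shape

def corner (f : Flag Ω) : Corner Ω := ⟨f.face, f.idx⟩

def otherIdx (f : Flag Ω) : Fin (Ω f.face).shape.sides :=
  if f.forward then f.idx + 1 else f.idx - 1

def edge (f : Flag Ω) : PolyEdge Ω := ⟨f.face, if f.forward then f.idx else f.idx - 1⟩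

/-- The same vertex with the other incident edge. -/
def opp (f : Flag Ω) : Flag Ω := ⟨f.face, f.idx, !f.forward⟩

/-- The same edge with its other end-point. -/
def rev (f : Flag Ω) : Flag Ω := ⟨f.face, f.otherIdx, !f.forward⟩

/-- The vertex of the flag. -/
def base (f : Flag Ω) : Plane := (Ω f.face).vert f.idx

/-- The vector along the edge of the flag, from its vertex to the other end-point. -/
def dirU (f : Flag Ω) : Plane := (Ω f.face).vert f.otherIdx - f.base

/-- The vector along the other edge at the vertex of the flag. -/
def dirV (f : Flag Ω) : Plane := (Ω f.face).vert f.opp.otherIdx - f.base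

/-- The expression of a polynomial function on the plane in the standard coordinates `(u, v)`
attached to the edge of the flag, with `u = 0` at the vertex of the flag. The point with the
coordinates `(u, v)` is `base + u • dirU + v • dirV`. The variable `X 0` of the result
is `u`, and `X 1` is `v`. -/
def localExpr (f : Flag Ω) : MvPolynomial (Fin 2) ℝ →ₐ[ℝ] MvPolynomial (Fin 2) ℝ :=
  MvPolynomial.aeval fun i =>
    MvPolynomial.C (f.base i) + MvPolynomial.C (f.dirU i) * MvPolynomial.X 0
      + MvPolynomial.C (f.dirV i) * MvPolynomial.X 1

/-- The value of `g` at the point `(u, 0)` of the edge. -/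
def val (f : Flag Ω) (g : MvPolynomial (Fin 2) ℝ) (u : ℝ) : ℝ :=
  MvPolynomial.eval ![u, 0] (f.localExpr g)

/-- The derivative `∂g/∂u` at the point `(u, 0)` of the edge. -/
def du (f : Flag Ω) (g : MvPolynomial (Fin 2) ℝ) (u : ℝ) : ℝ :=
  MvPolynomial.eval ![u, 0] (MvPolynomial.pderiv 0 (f.localExpr g))

/-- The derivative `∂g/∂v` at the point `(u, 0)` of the edge. -/
def dv (f : Flag Ω) (g : MvPolynomial (Fin 2) ℝ) (u : ℝ) : ℝ :=
  MvPolynomial.eval ![u, 0] (MvPolynomial.pderiv 1 (f.localExpr g))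

end Flag

/-! ## Surfaces before the restrictions around vertices -/

/-- Polygons `Ω x` (`x : K₀`), glued along pairs of polygonal edges (`k : K₁`) by affine
homeomorphisms, with rational gluing data. The homeomorphism with the index `k` maps the edge of
the flag `src k` to the edge of the flag `tgt k`, and the vertex of the former to the vertex
of the latter. The gluing data is written in the standard coordinates of these two flags:
`∂/∂v₁ = β(u₁) ∂/∂u₂ + γ(u₁) ∂/∂v₂`. -/
structure PreSurface (K₀ K₁ : Type*) where
  Ω : K₀ → Polygon
  src : K₁ → Flag Ω
  tgt : K₁ → Flag Ω
  /-- An edge is glued to at most one other edge, and not to itself. -/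
  edges_injective : Function.Injective
    (Sum.elim (fun k => (src k).edge) (fun k => (tgt k).edge) : K₁ ⊕ K₁ → PolyEdge Ω)
  nonempty : Nonempty K₀
  connected : ∀ x y : K₀,
    Relation.EqvGen (fun x y => ∃ k, (src k).face = x ∧ (tgt k).face = y) x y
  data : K₁ → GluingPoly
  coprime : ∀ k, ∀ d : ℝ[X], d ∣ (data k).a → d ∣ (data k).b → d ∣ (data k).c → IsUnit d
  /-- `β` and `γ` are continuous on the edge: no poles. -/
  a_ne_zero : ∀ k, ∀ u ∈ Set.Icc (0 : ℝ) 1, (data k).a.eval u ≠ 0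
  gamma_neg : ∀ k, ∀ u ∈ Set.Icc (0 : ℝ) 1, (data k).gamma u < 0

namespace PreSurface

variable {K₀ K₁ : Type*} (M : PreSurface K₀ K₁)

/-- `M.Glued f f' D`: the edge of `f` is glued to the edge of `f'`, with the vertex of `f` going to
the vertex of `f'`, and the gluing is given by `D` in the standard coordinates of `f` and `f'`.
Each gluing can be read in both directions and from both end-points. -/
inductive Glued : Flag M.Ω → Flag M.Ω → GluingPoly → Prop
  | direct (k : K₁) : Glued (M.src k) (M.tgt k) (M.data k)
  | inverse (k : K₁) : Glued (M.tgt k) (M.src k) (M.data k).swap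
  | directRev (k : K₁) : Glued (M.src k).rev (M.tgt k).rev
      ((M.data k).reverse (M.src k).shape (M.tgt k).shape)
  | inverseRev (k : K₁) : Glued (M.tgt k).rev (M.src k).rev
      ((M.data k).reverse (M.src k).shape (M.tgt k).shape).swap

/-- A polygonal edge that is not glued to another one. -/
def IsBoundaryEdge (e : PolyEdge M.Ω) : Prop := ∀ k, (M.src k).edge ≠ e ∧ (M.tgt k).edge ≠ e

/-- The vertices of the surface: classes of identified polygonal vertices. -/
def Vertex : Type _ :=
  Quot fun p q : Corner M.Ω => ∃ f f' D, M.Glued f f' D ∧ f.corner = p ∧ f'.corner = q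

/-- The class of a polygonal vertex. -/
def vertexOf (p : Corner M.Ω) : M.Vertex := Quot.mk _ p

/-- The `n` polygonal corners at an interior vertex, in cyclic order. The corner `P_k` with its edge
`τ_k` is the flag `f k`, for `1 ≤ k ≤ n`, and `f 0 = f n`. The edge `τ_k` is glued to the other
edge `τ'_{k-1}` at the corner `P_{k-1}`, by `D k` in standard coordinates. -/
structure IsInteriorStar (n : ℕ) (f : ℕ → Flag M.Ω) (D : ℕ → GluingPoly) : Prop where
  pos : 0 < n
  injOn : Set.InjOn f (Set.Icc 1 n)
  cyclic : f 0 = f n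
  glued : ∀ k < n, M.Glued (f (k + 1)) (f k).opp (D (k + 1))

/-- The `m + 1` polygonal corners at a boundary vertex, in linear order, as the flags
`f 0, …, f m`. -/
structure IsBoundaryStar (m : ℕ) (f : ℕ → Flag M.Ω) (D : ℕ → GluingPoly) : Prop where
  first : M.IsBoundaryEdge (f 0).edge
  last : M.IsBoundaryEdge (f m).opp.edge
  glued : ∀ k < m, M.Glued (f (k + 1)) (f k).opp (D (k + 1))

/-- Four corners around an interior vertex such that all four edges are joining, that is,
`β = 0` at the vertex in standard coordinates. -/
def IsCrossingStar (f : ℕ → Flag M.Ω) (D : ℕ → GluingPoly) : Prop :=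
  M.IsInteriorStar 4 f D ∧ ∀ k ∈ Finset.Icc 1 4, (D k).beta 0 = 0

end PreSurface

/-! ## Rational `G¹` polygonal surfaces made up of rectangles and triangles -/

structure Surface (K₀ K₁ : Type*) extends PreSurface K₀ K₁ where
  /-- Around an interior vertex the tangent spaces are identified consistently. -/
  tangent_cycle : ∀ n f D, toPreSurface.IsInteriorStar n f D → tangentProd D n = 1
  /-- The tangent sectors at an interior vertex do not wind up. -/
  interior_sectors : ∀ n f D, toPreSurface.IsInteriorStar n f D →
    ∀ k, 1 ≤ k → k < n → NoOverlap (tangentProd D k)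
  /-- The two differential restrictions at a crossing vertex. -/
  crossing : ∀ f D, toPreSurface.IsCrossingStar f D →
    deriv (D 1).beta 0 + deriv (D 2).gamma 0 / (D 2).gamma 0 =
        -(D 1).gamma 0 * (deriv (D 3).beta 0 + deriv (D 4).gamma 0 / (D 4).gamma 0) ∧
    deriv (D 2).beta 0 + deriv (D 3).gamma 0 / (D 3).gamma 0 =
        -(D 2).gamma 0 * (deriv (D 4).beta 0 + deriv (D 1).gamma 0 / (D 1).gamma 0)
  /-- The tangent sectors at a boundary vertex do not wind up and do not close up. -/
  boundary_sectors : ∀ m f D, toPreSurface.IsBoundaryStar m f D →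
    (∀ k, 1 ≤ k → k ≤ m → NoOverlap (tangentProd D k)) ∧
    ¬ (tangentProd D m 1 0 = 1 ∧ tangentProd D m 1 1 = 0)

namespace Surface

variable {K₀ K₁ : Type*} (M : Surface K₀ K₁)

/-- The number of rectangles. -/
def numRect : ℕ := Nat.card {x : K₀ // (M.Ω x).shape = Shape.rectangle}

/-- The number of triangles. -/
def numTri : ℕ := Nat.card {x : K₀ // (M.Ω x).shape = Shape.triangle}

/-- The number of vertices of the surface. -/
def numVert : ℕ := Nat.card M.Vertex

/-- The number of crossing vertices. -/
def numCrossing : ℕ :=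
  Nat.card {P : M.Vertex // ∃ f D, M.IsCrossingStar f D ∧ M.vertexOf (f 1).corner = P}

/-- The number of boundary edges. -/
def numBoundaryEdge : ℕ := Nat.card {e : PolyEdge M.Ω // M.IsBoundaryEdge e}

/-- `δ` of an interior edge: the maximum of `r₁ + deg a`, `deg b`, `r₂ + deg c`. -/
def deltaEdge (k : K₁) : ℕ :=
  max ((M.src k).shape.r + (M.data k).a.natDegree)
    (max (M.data k).b.natDegree ((M.tgt k).shape.r + (M.data k).c.natDegree))

/-- The sum of `δ` over the interior edges. -/
def delta [Fintype K₁] : ℕ := ∑ k, M.deltaEdge k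

/-- The polynomial `G¹` splines: families of polynomial functions on the polygons whose values
match along the glued edges, and `∂g₁/∂v₁ = β ∂g₂/∂u₂ + γ ∂g₂/∂v₂` there. -/
def splineSpace : Submodule ℝ (K₀ → MvPolynomial (Fin 2) ℝ) where
  carrier := {g | ∀ k, ∀ u ∈ Set.Icc (0 : ℝ) 1,
    (M.src k).val (g (M.src k).face) u = (M.tgt k).val (g (M.tgt k).face) u ∧
    (M.src k).dv (g (M.src k).face) u =
      (M.data k).beta u * (M.tgt k).du (g (M.tgt k).face) u
        + (M.data k).gamma u * (M.tgt k).dv (g (M.tgt k).face) u}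
  zero_mem' := by
    intro k u _
    simp [Flag.val, Flag.du, Flag.dv]
  add_mem' := by
    intro g h hg hh k u hu
    obtain ⟨h1, h2⟩ := hg k u hu
    obtain ⟨h3, h4⟩ := hh k u hu
    simp only [Flag.val, Flag.du, Flag.dv, Pi.add_apply, map_add] at *
    exact ⟨by rw [h1, h3], by rw [h2, h4]; ring⟩
  smul_mem' := by
    intro r g hg k u hu
    obtain ⟨h1, h2⟩ := hg k u hu
    simp only [Flag.val, Flag.du, Flag.dv, Pi.smul_apply, map_smul, MvPolynomial.smul_eval,
      Derivation.map_smul] at *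
    exact ⟨by rw [h1], by rw [h2]; ring⟩

/-- The polynomial functions of degree `≤ k` on a triangle, and of bidegree `≤ (k, k)` in
coordinates along the sides of a rectangle. -/
def degreeLE (k : ℕ) : Submodule ℝ (K₀ → MvPolynomial (Fin 2) ℝ) where
  carrier := {g | ∀ x,
    ((M.Ω x).shape = Shape.triangle → (g x).totalDegree ≤ k) ∧
    ((M.Ω x).shape = Shape.rectangle → ∀ f : Flag M.Ω, f.face = x →
      f.localExpr (g x) ∈ MvPolynomial.restrictDegree (Fin 2) ℝ k)}
  zero_mem' := by
    intro x
    simp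
  add_mem' := by
    intro g h hg hh x
    refine ⟨fun hx => ?_, fun hx f hf => ?_⟩
    · exact (MvPolynomial.totalDegree_add _ _).trans (max_le ((hg x).1 hx) ((hh x).1 hx))
    · simpa using Submodule.add_mem _ ((hg x).2 hx f hf) ((hh x).2 hx f hf)
  smul_mem' := by
    intro r g hg x
    refine ⟨fun hx => ?_, fun hx f hf => ?_⟩
    · exact (MvPolynomial.totalDegree_smul_le _ _).trans ((hg x).1 hx)
    · simpa using Submodule.smul_mem _ r ((hg x).2 hx f hf)

/-- The space `S¹_k` of the splines of degree at most `k`. -/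
def splines (k : ℕ) : Submodule ℝ (K₀ → MvPolynomial (Fin 2) ℝ) :=
  M.splineSpace ⊓ M.degreeLE k

end Surface

end G1Spline

end

/-! The spline conditions are a linear system on the space `degreeLE k` of all polynomial families.
Along a glued edge, after the denominator a is cleared, the deviations from the two conditions are a
polynomial of degree at most k and one of degree less than δ + k (`errMap_mem_errSpace`). A family
without errors is a spline, so the naive count gives dim `degreeLE k` − dim `errSpace k`. The bound
improves on it because the errors satisfy automatic linear relations: each independent relation adds
one to the dimension of the kernel (`finrank_le_finrank_ker`).

The relations come from interior vertices. Consider linear combinations of the value, the two first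
derivatives and the mixed derivative at a corner. When the coefficients are transported by
`jetMatrix`, the difference of such combinations at consecutive corners is a functional of the error
on the edge between them (`Flag.jetErr_err`). Around the vertex these differences telescope to zero
if the coefficients return to their initial values (`coef_last`). For the value and the first
derivatives this follows from the triviality of the product of tangent matrices, which gives three
relations. The mixed derivative can be transported where β(0) = 0; at a crossing vertex the two
differential restrictions make it return as well (`jetProd_four_eq_one`), which gives a fourth.

Independence on `errSpace k` (`eq_zero_of_relation_eq_zero`) is the delicate point. Errors supported
on one edge and invisible at its other end isolate single coefficients, and there is enough room for
them unless k = 2 and δ ≤ 1. In these small cases a nonzero mixed coefficient is excluded by signs: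
γ < 0, while a and c have no zeros on [0,1] (`mixedParam_eq_zero`).

The rest is counting. A vertex that is not interior carries two ends of boundary edges
(`card_vertex_le`), and every polygonal edge is either a boundary edge or one of two glued sides
(`card_polyEdge`). -/

noncomputable section

namespace G1Spline

/-! ## Linear algebra -/

/-- If a family of functionals, injectively parametrised by `U`, vanishes on the range of `Φ`,
then the kernel of `Φ` is larger than expected by at least the dimension of `U`. -/
theorem finrank_le_finrank_ker {V W U : Type*} [AddCommGroup V] [Module ℝ V]
    [AddCommGroup W] [Module ℝ W] [AddCommGroup U] [Module ℝ U]
    [FiniteDimensional ℝ V] [FiniteDimensional ℝ W]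
    (Φ : V →ₗ[ℝ] W) (L : U →ₗ[ℝ] Module.Dual ℝ W)
    (hL : ∀ u v, L u (Φ v) = 0) (hinj : ∀ u, L u = 0 → u = 0) :
    Module.finrank ℝ V + Module.finrank ℝ U ≤
      Module.finrank ℝ (LinearMap.ker Φ) + Module.finrank ℝ W := by
  have h1 := LinearMap.finrank_range_add_finrank_ker Φ
  have h2 := Subspace.finrank_add_finrank_dualAnnihilator_eq (LinearMap.range Φ)
  -- The relations embed `U` into the annihilator of the range, whose dimension is dim `W` − rank
  -- `Φ`.
  have h3 : Module.finrank ℝ U ≤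
      Module.finrank ℝ (LinearMap.range Φ).dualAnnihilator := by
    have hmem : ∀ u, L u ∈ (LinearMap.range Φ).dualAnnihilator := by
      intro u
      rw [Submodule.mem_dualAnnihilator]
      rintro _ ⟨v, rfl⟩
      exact hL u v
    refine LinearMap.finrank_le_finrank_of_injective (f := L.codRestrict _ hmem) ?_
    rw [injective_iff_map_eq_zero]
    intro u hu
    exact hinj u (congrArg Subtype.val hu)
  omega

/-! ### Dimensions of polynomial spaces -/

theorem finrank_degreeLT (n : ℕ) : Module.finrank ℝ (Polynomial.degreeLT ℝ n) = n := by
  simpa using (Polynomial.degreeLTEquiv ℝ n).finrank_eq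

instance finite_degreeLT (n : ℕ) : FiniteDimensional ℝ (Polynomial.degreeLT ℝ n) :=
  Module.Finite.equiv (Polynomial.degreeLTEquiv ℝ n).symm

theorem finrank_restrictDegree (k : ℕ) :
    Module.finrank ℝ (MvPolynomial.restrictDegree (Fin 2) ℝ k) = (k + 1) ^ 2 := by
  have h := Module.finrank_eq_nat_card_basis
    (MvPolynomial.basisRestrictSupport ℝ {s : Fin 2 →₀ ℕ | ∀ i, s i ≤ k})
  have e : {s : Fin 2 →₀ ℕ | ∀ i, s i ≤ k} ≃ (Fin 2 → Fin (k + 1)) :=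
    { toFun := fun s i => ⟨s.1 i, Nat.lt_succ_of_le (s.2 i)⟩
      invFun := fun s => ⟨Finsupp.equivFunOnFinite.symm fun i => s i, fun i => by
        simpa using Nat.lt_succ_iff.mp (s i).2⟩
      left_inv := fun s => by ext; simp
      right_inv := fun s => by ext; simp }
  rw [Nat.card_congr e] at h
  rw [MvPolynomial.restrictDegree, h]
  simp

/-- There are n + 1 exponent pairs of total degree n, and these sum to a triangular number. The
doubling avoids division in ℕ. -/
theorem card_finsupp_degree_le (k : ℕ) :
    Nat.card {s : Fin 2 →₀ ℕ | s.degree ≤ k} * 2 = (k + 1) * (k + 2) := by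
  have e : {s : Fin 2 →₀ ℕ | s.degree ≤ k} ≃
      (Σ n : Fin (k + 1), Finset.HasAntidiagonal.antidiagonal (n : ℕ)) :=
    { toFun := fun s => ⟨⟨s.1 0 + s.1 1, by
          have := s.2
          simp only [Set.mem_ofPred_eq, Finsupp.degree_eq_sum, Fin.sum_univ_two] at this
          omega⟩, ⟨(s.1 0, s.1 1), by simp⟩⟩
      invFun := fun s => ⟨Finsupp.equivFunOnFinite.symm ![s.2.1.1, s.2.1.2], by
          obtain ⟨⟨n, hn⟩, ⟨⟨a, b⟩, hab⟩⟩ := s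
          simp only [Finset.HasAntidiagonal.mem_antidiagonal] at hab
          simp [Finsupp.degree_eq_sum]
          omega⟩
      left_inv := fun s => by
        ext i
        fin_cases i <;> simp
      right_inv := by
        rintro ⟨⟨n, hn⟩, ⟨⟨a, b⟩, hab⟩⟩
        simp only [Finset.HasAntidiagonal.mem_antidiagonal] at hab
        subst hab
        simp }
  rw [Nat.card_congr e, Nat.card_eq_fintype_card, Fintype.card_sigma]
  simp only [Fintype.card_coe, Finset.Nat.card_antidiagonal]
  rw [Fin.sum_univ_eq_sum_range (fun n => n + 1) (k + 1)]
  have h := Finset.sum_range_id_mul_two (k + 2)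
  rw [Finset.sum_range_succ'] at h
  rw [add_zero] at h
  rw [h, mul_comm]
  rfl

theorem finrank_restrictTotalDegree (k : ℕ) :
    Module.finrank ℝ (MvPolynomial.restrictTotalDegree (Fin 2) ℝ k) * 2 = (k + 1) * (k + 2) := by
  have h := Module.finrank_eq_nat_card_basis
    (MvPolynomial.basisRestrictSupport ℝ {s : Fin 2 →₀ ℕ | s.degree ≤ k})
  rw [← card_finsupp_degree_le, ← h]
  rfl

/-! ## Polygons -/

theorem Polygon.triangle_vert (P : Polygon) (h : P.shape = Shape.triangle)
    (i : Fin P.shape.sides) : P.vert (i + 1 + 1) = P.vert (i - 1) := by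
  obtain ⟨shape, vert, nd, ra⟩ := P
  obtain rfl : shape = Shape.triangle := h
  have : ∀ i : Fin 3, i + 1 + 1 = i - 1 := by decide
  exact congrArg vert (this i)

/-- The squared norm of the difference of the two sides equals the sum of the inner products at the
four corners, all of which vanish. -/
theorem Polygon.rectangle_parallel (P : Polygon) (h : P.shape = Shape.rectangle)
    (i : Fin P.shape.sides) :
    P.vert (i + 1 + 1) - P.vert (i + 1) = P.vert (i - 1) - P.vert i := by
  obtain ⟨shape, vert, nd, ra⟩ := P
  obtain rfl : shape = Shape.rectangle := h
  replace ra := ra rfl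
  change Fin 4 → Plane at vert
  change ∀ i : Fin 4, inner ℝ (vert (i + 1) - vert i) (vert (i - 1) - vert i) = 0 at ra
  change Fin 4 at i
  change vert (i + 1 + 1) - vert (i + 1) = vert (i - 1) - vert i
  have h1 := ra i
  have h2 := ra (i + 1)
  have h3 := ra (i + 1 + 1)
  have h4 := ra (i - 1)
  have e1 : ∀ i : Fin 4, i + 1 - 1 = i := by decide
  have e2 : ∀ i : Fin 4, i + 1 + 1 + 1 = i - 1 := by decide
  have e3 : ∀ i : Fin 4, i - 1 - 1 = i + 1 + 1 := by decide
  have e4 : ∀ i : Fin 4, i - 1 + 1 = i := by decide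
  rw [e1] at h2
  rw [e1, e2] at h3
  rw [e3, e4] at h4
  rw [← sub_eq_zero, ← inner_self_eq_zero (𝕜 := ℝ)]
  simp only [inner_sub_left, inner_sub_right] at *
  rw [real_inner_comm (vert (i + 1)) (vert i), real_inner_comm (vert (i + 1 + 1)) (vert i),
    real_inner_comm (vert (i - 1)) (vert i),
    real_inner_comm (vert (i + 1 + 1)) (vert (i + 1)), real_inner_comm (vert (i - 1)) (vert (i + 1)),
    real_inner_comm (vert (i - 1)) (vert (i + 1 + 1))] at *
  linarith

namespace Flag

variable {K₀ : Type*} {Ω : K₀ → Polygon}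

@[simp] theorem opp_opp (f : Flag Ω) : f.opp.opp = f := by
  simp [opp]

@[simp] theorem rev_edge (f : Flag Ω) : f.rev.edge = f.edge := by
  obtain ⟨x, i, b⟩ := f
  cases b
  · rfl
  · exact congrArg (fun j => (⟨x, j⟩ : PolyEdge Ω)) (add_sub_cancel_right i 1)

@[simp] theorem opp_corner (f : Flag Ω) : f.opp.corner = f.corner := rfl

theorem opp_ne (f : Flag Ω) : f.opp ≠ f := by
  intro h
  have := congrArg Flag.forward h
  simp [opp] at this

theorem rev_ne (f : Flag Ω) : f.rev ≠ f := by
  intro h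
  have := congrArg Flag.forward h
  simp [rev] at this

theorem dirU_rev (f : Flag Ω) : f.rev.dirU = -f.dirU := by
  obtain ⟨x, i, b⟩ := f
  cases b
  · change (Ω x).vert (i - 1 + 1) - (Ω x).vert (i - 1) = -((Ω x).vert (i - 1) - (Ω x).vert i)
    rw [sub_add_cancel, neg_sub]
  · change (Ω x).vert (i + 1 - 1) - (Ω x).vert (i + 1) = -((Ω x).vert (i + 1) - (Ω x).vert i)
    rw [add_sub_cancel_right, neg_sub]

theorem base_rev (f : Flag Ω) : f.rev.base = f.base + f.dirU := by
  simp [dirU, base, rev]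

/-- With P, Q the ends of the edge and R next to P: on a triangle the other edge at Q leads to R as
well, and R − Q = (R − P) − (Q − P). On a rectangle it is a parallel translate of PR. The factor 1 −
r covers both. -/
theorem dirV_rev (f : Flag Ω) : f.rev.dirV = f.dirV - (1 - (f.shape.r : ℝ)) • f.dirU := by
  have hs : f.shape = Shape.triangle ∨ f.shape = Shape.rectangle := by
    cases f.shape <;> simp
  obtain ⟨x, i, b⟩ := f
  have e : (⟨x, i, b⟩ : Flag Ω).rev.dirV - (⟨x, i, b⟩ : Flag Ω).dirV =
      if b then ((Ω x).vert (i + 1 + 1) - (Ω x).vert (i + 1)) - ((Ω x).vert (i - 1) - (Ω x).vert i)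
      else ((Ω x).vert (i - 1 - 1) - (Ω x).vert (i - 1)) -
        ((Ω x).vert (i + 1) - (Ω x).vert i) := by
    cases b <;> rfl
  have e' : (⟨x, i, b⟩ : Flag Ω).dirU =
      if b then (Ω x).vert (i + 1) - (Ω x).vert i else (Ω x).vert (i - 1) - (Ω x).vert i := by
    cases b <;> rfl
  rw [sub_eq_add_neg, ← sub_eq_iff_eq_add', e, e']
  rcases hs with hs | hs
  · rw [hs]
    have h1 := (Ω x).triangle_vert hs i
    have h2 := (Ω x).triangle_vert hs (i - 1)
    rw [sub_add_cancel] at h2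
    cases b
    · simp [Shape.r, h2]
    · simp [Shape.r, h1]
  · rw [hs]
    have h1 := (Ω x).rectangle_parallel hs i
    have h2 := (Ω x).rectangle_parallel hs (i - 1)
    rw [sub_add_cancel] at h2
    cases b
    · simp [Shape.r, h2]
    · simp [Shape.r, h1]

/-! ## Restriction of polynomials to an edge -/

/-- The restriction of a polynomial function to the edge `v = 0`, as a polynomial in `u`. -/
def valP (f : Flag Ω) : MvPolynomial (Fin 2) ℝ →ₐ[ℝ] ℝ[X] :=
  (MvPolynomial.aeval ![Polynomial.X, 0]).comp f.localExpr

/-- The restriction of `∂g/∂u` to the edge, as a polynomial in `u`. -/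
def duP (f : Flag Ω) : MvPolynomial (Fin 2) ℝ →ₗ[ℝ] ℝ[X] :=
  Polynomial.derivative ∘ₗ f.valP.toLinearMap

/-- The restriction of `∂g/∂v` to the edge, as a polynomial in `u`. -/
def dvP (f : Flag Ω) : MvPolynomial (Fin 2) ℝ →ₗ[ℝ] ℝ[X] :=
  (MvPolynomial.aeval ![Polynomial.X, 0]).toLinearMap ∘ₗ
    (MvPolynomial.pderiv 1 : Derivation ℝ (MvPolynomial (Fin 2) ℝ) _).toLinearMap ∘ₗ
      f.localExpr.toLinearMap

theorem duP_apply (f : Flag Ω) (g : MvPolynomial (Fin 2) ℝ) :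
    f.duP g = Polynomial.derivative (f.valP g) := rfl

theorem localExpr_X (f : Flag Ω) (i : Fin 2) : f.localExpr (MvPolynomial.X i) =
    MvPolynomial.C (f.base i) + MvPolynomial.C (f.dirU i) * MvPolynomial.X 0
      + MvPolynomial.C (f.dirV i) * MvPolynomial.X 1 := by
  simp [localExpr]

theorem valP_X (f : Flag Ω) (i : Fin 2) : f.valP (MvPolynomial.X i) =
    Polynomial.C (f.base i) + Polynomial.C (f.dirU i) * Polynomial.X := by
  simp [valP, localExpr_X, MvPolynomial.algHom_C]

theorem dvP_X (f : Flag Ω) (i : Fin 2) : f.dvP (MvPolynomial.X i) = Polynomial.C (f.dirV i) := by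
  simp [dvP, localExpr_X, MvPolynomial.algHom_C, MvPolynomial.pderiv_X]

theorem dvP_C (f : Flag Ω) (r : ℝ) : f.dvP (MvPolynomial.C r) = 0 := by
  simp [dvP, MvPolynomial.algHom_C]

theorem dvP_mul (f : Flag Ω) (g h : MvPolynomial (Fin 2) ℝ) :
    f.dvP (g * h) = f.valP g * f.dvP h + f.valP h * f.dvP g := by
  simp [dvP, valP]

/-- The splines are defined by pointwise conditions, whereas degrees are counted on polynomials;
this and the next two lemmas connect the two. -/
theorem eval_aeval (q : MvPolynomial (Fin 2) ℝ) (u : ℝ) :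
    (MvPolynomial.aeval ![Polynomial.X, 0] q : ℝ[X]).eval u = MvPolynomial.eval ![u, 0] q := by
  induction q using MvPolynomial.induction_on with
  | C r => simp [MvPolynomial.algHom_C]
  | add p q hp hq => simp [hp, hq]
  | mul_X p i hp =>
    rw [map_mul, Polynomial.eval_mul, hp]
    fin_cases i <;> simp

theorem eval_valP (f : Flag Ω) (g : MvPolynomial (Fin 2) ℝ) (u : ℝ) :
    (f.valP g).eval u = f.val g u := by
  exact eval_aeval (f.localExpr g) u

theorem eval_dvP (f : Flag Ω) (g : MvPolynomial (Fin 2) ℝ) (u : ℝ) :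
    (f.dvP g).eval u = f.dv g u :=
  eval_aeval _ _

theorem derivative_aeval (q : MvPolynomial (Fin 2) ℝ) :
    Polynomial.derivative (MvPolynomial.aeval ![Polynomial.X, 0] q : ℝ[X]) =
      MvPolynomial.aeval ![Polynomial.X, 0] (MvPolynomial.pderiv 0 q) := by
  induction q using MvPolynomial.induction_on with
  | C r => simp [MvPolynomial.algHom_C]
  | add p q hp hq => simp [hp, hq]
  | mul_X p i hp =>
    rw [map_mul, Polynomial.derivative_mul, hp]
    fin_cases i
    · simp [MvPolynomial.pderiv_X]
      ring
    · simp [MvPolynomial.pderiv_X]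

theorem eval_duP (f : Flag Ω) (g : MvPolynomial (Fin 2) ℝ) (u : ℝ) :
    (f.duP g).eval u = f.du g u := by
  rw [duP_apply, valP, AlgHom.comp_apply, derivative_aeval]
  exact eval_aeval _ _

/-! ### Change of the edge or of its starting point -/

theorem valP_rev (f : Flag Ω) (g : MvPolynomial (Fin 2) ℝ) :
    f.rev.valP g = (f.valP g).comp (1 - Polynomial.X) := by
  induction g using MvPolynomial.induction_on with
  | C r => simp
  | add p q hp hq => simp [hp, hq]
  | mul_X p i hp =>
    rw [map_mul, map_mul, Polynomial.mul_comp, hp, valP_X, valP_X, dirU_rev, base_rev]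
    congr 1
    simp
    ring

theorem duP_rev (f : Flag Ω) (g : MvPolynomial (Fin 2) ℝ) :
    f.rev.duP g = -(f.duP g).comp (1 - Polynomial.X) := by
  rw [duP_apply, valP_rev, Polynomial.derivative_comp, duP_apply]
  simp

/-- Chain rule for (u, v) ↦ (1 − u − v, v) on a triangle and (1 − u, v) on a rectangle. -/
theorem dvP_rev (f : Flag Ω) (g : MvPolynomial (Fin 2) ℝ) :
    f.rev.dvP g =
      (f.dvP g - Polynomial.C (1 - (f.shape.r : ℝ)) * f.duP g).comp (1 - Polynomial.X) := by
  induction g using MvPolynomial.induction_on with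
  | C r => simp [dvP_C, duP_apply]
  | add p q hp hq =>
    rw [map_add, map_add, map_add, hp, hq]
    simp
    ring
  | mul_X p i hp =>
    rw [dvP_mul, dvP_mul, hp, valP_rev, valP_X, valP_X, dvP_X, dvP_X, dirU_rev, base_rev,
      dirV_rev, duP_apply, duP_apply, map_mul, valP_X]
    simp
    ring

@[simp] theorem base_opp (f : Flag Ω) : f.opp.base = f.base := rfl

@[simp] theorem dirU_opp (f : Flag Ω) : f.opp.dirU = f.dirV := rfl

@[simp] theorem dirV_opp (f : Flag Ω) : f.opp.dirV = f.dirU := by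
  obtain ⟨x, i, b⟩ := f
  cases b <;> rfl

theorem eval_valP_opp (f : Flag Ω) (g : MvPolynomial (Fin 2) ℝ) :
    (f.opp.valP g).eval 0 = (f.valP g).eval 0 := by
  induction g using MvPolynomial.induction_on with
  | C r => simp
  | add p q hp hq => simp [hp, hq]
  | mul_X p i hp => simp [valP_X, hp]

theorem eval_duP_opp (f : Flag Ω) (g : MvPolynomial (Fin 2) ℝ) :
    (f.opp.duP g).eval 0 = (f.dvP g).eval 0 := by
  induction g using MvPolynomial.induction_on with
  | C r => simp [duP_apply, dvP_C]
  | add p q hp hq => simp [hp, hq]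
  | mul_X p i hp =>
    rw [duP_apply] at hp ⊢
    simp [valP_X, dvP_mul, dvP_X, hp, eval_valP_opp]
    ring

theorem eval_dvP_opp (f : Flag Ω) (g : MvPolynomial (Fin 2) ℝ) :
    (f.opp.dvP g).eval 0 = (f.duP g).eval 0 := by
  rw [← eval_duP_opp, opp_opp]

/-- Passing to the other edge at the corner exchanges u and v, and mixed partial derivatives are
symmetric. This carries the mixed derivative across a corner. -/
theorem eval_mixed_opp (f : Flag Ω) (g : MvPolynomial (Fin 2) ℝ) :
    (Polynomial.derivative (f.opp.dvP g)).eval 0 = (Polynomial.derivative (f.dvP g)).eval 0 := by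
  induction g using MvPolynomial.induction_on with
  | C r => simp [dvP_C]
  | add p q hp hq => simp [hp, hq]
  | mul_X p i hp =>
    have h1 := eval_duP_opp f p
    have h2 := eval_dvP_opp f p
    rw [duP_apply] at h1 h2
    simp [valP_X, dvP_mul, dvP_X, hp, h1, h2]
    ring

/-! ### Degrees -/

theorem natDegree_aeval_le (q : MvPolynomial (Fin 2) ℝ) (m : ℕ)
    (h : ∀ s ∈ q.support, s 1 = 0 → s 0 ≤ m) :
    (MvPolynomial.aeval ![Polynomial.X, 0] q : ℝ[X]).natDegree ≤ m := by
  rw [q.as_sum, map_sum]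
  refine Polynomial.natDegree_sum_le_of_forall_le _ _ fun s hs => ?_
  rw [MvPolynomial.aeval_monomial]
  by_cases h1 : s 1 = 0
  · simp only [Finsupp.prod_fintype, Fin.prod_univ_two, pow_zero, implies_true, h1]
    refine (Polynomial.natDegree_C_mul_le _ _).trans ?_
    simpa using h s hs h1
  · simp [Finsupp.prod_fintype, Fin.prod_univ_two, h1]

/-- Only monomials linear in v survive ∂/∂v followed by v = 0. On a triangle this saves one degree,
on a rectangle it does not. -/
theorem natDegree_aeval_pderiv_le (q : MvPolynomial (Fin 2) ℝ) (m : ℕ)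
    (h : ∀ s ∈ q.support, s 1 = 1 → s 0 ≤ m) :
    (MvPolynomial.aeval ![Polynomial.X, 0] (MvPolynomial.pderiv 1 q) : ℝ[X]).natDegree ≤ m := by
  rw [q.as_sum, map_sum, map_sum]
  refine Polynomial.natDegree_sum_le_of_forall_le _ _ fun s hs => ?_
  rw [MvPolynomial.pderiv_monomial, MvPolynomial.aeval_monomial]
  by_cases h1 : s 1 = 1
  · rw [Finsupp.prod_fintype _ _ (by simp)]
    refine (Polynomial.natDegree_C_mul_le _ _).trans ?_
    simpa [Fin.prod_univ_two, h1] using h s hs h1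
  · by_cases h0 : s 1 = 0
    · simp [h0]
    · rw [Finsupp.prod_fintype _ _ (by simp)]
      have : s 1 - 1 ≠ 0 := by omega
      simp [Fin.prod_univ_two, this]

end Flag

/-! ### Degrees under affine changes of coordinates -/

open MvPolynomial in
theorem totalDegree_aeval_le {σ τ : Type*} [Fintype σ] (t : σ → MvPolynomial τ ℝ)
    (ht : ∀ i, (t i).totalDegree ≤ 1) (p : MvPolynomial σ ℝ) :
    (aeval t p).totalDegree ≤ p.totalDegree := by
  conv_lhs => rw [p.as_sum, map_sum]
  refine (totalDegree_finsetSum _ _).trans (Finset.sup_le fun s hs => ?_)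
  rw [aeval_monomial, Finsupp.prod_fintype _ _ (by simp)]
  refine (totalDegree_mul _ _).trans ?_
  rw [algebraMap_eq, totalDegree_C, zero_add]
  refine (totalDegree_finsetProd _ _).trans ?_
  refine le_trans (Finset.sum_le_sum fun i _ => ?_) ((Finsupp.sum_fintype s (fun _ e => e)
    (by simp)).symm.le.trans (le_totalDegree hs))
  exact (totalDegree_pow _ _).trans (by simpa using Nat.mul_le_mul_left (s i) (ht i))

open MvPolynomial in
-- The variable `j` enters only through the substitute of `i₀`, and there linearly. Swaps and
-- reflections of rectangle coordinates have this form.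
theorem degreeOf_aeval_le {σ τ : Type*} [Fintype σ] [DecidableEq σ] (t : σ → MvPolynomial τ ℝ)
    (j : τ) (i₀ : σ) (ht : ∀ i, (t i).degreeOf j ≤ if i = i₀ then 1 else 0)
    (p : MvPolynomial σ ℝ) :
    (aeval t p).degreeOf j ≤ p.degreeOf i₀ := by
  conv_lhs => rw [p.as_sum, map_sum]
  refine (degreeOf_sum_le _ _ _).trans (Finset.sup_le fun s hs => ?_)
  rw [aeval_monomial, Finsupp.prod_fintype _ _ (by simp), algebraMap_eq]
  refine (degreeOf_C_mul_le _ _ _).trans ?_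
  refine (degreeOf_prod_le _ _ _).trans ?_
  refine (Finset.sum_le_sum fun i _ => (degreeOf_pow_le _ _ _).trans
    (Nat.mul_le_mul_left (s i) (ht i))).trans ?_
  simpa using degreeOf_le_iff.mp le_rfl s hs

theorem mem_restrictDegree_iff_degreeOf {σ : Type*} (p : MvPolynomial σ ℝ) (k : ℕ) :
    p ∈ MvPolynomial.restrictDegree σ ℝ k ↔ ∀ i, p.degreeOf i ≤ k := by
  simp only [MvPolynomial.mem_restrictDegree, MvPolynomial.degreeOf_le_iff]
  exact ⟨fun h i s hs => h s hs i, fun h s hs i => h i s hs⟩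

theorem fin_induction {n : ℕ} [NeZero n] {P : Fin n → Prop} (h0 : P 0)
    (hs : ∀ i, P i → P (i + 1)) (i : Fin n) : P i := by
  obtain _ | n := n
  · exact i.elim0
  · induction i using Fin.induction with
    | zero => exact h0
    | succ i ih => simpa using hs _ ih

namespace Flag

variable {K₀ : Type*} {Ω : K₀ → Polygon}

theorem totalDegree_localExpr_le (f : Flag Ω) (g : MvPolynomial (Fin 2) ℝ) :
    (f.localExpr g).totalDegree ≤ g.totalDegree := by
  refine totalDegree_aeval_le _ (fun i => ?_) g
  refine (MvPolynomial.totalDegree_add _ _).trans (max_le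
    ((MvPolynomial.totalDegree_add _ _).trans (max_le ?_ ?_)) ?_)
  · simp
  · exact (MvPolynomial.totalDegree_mul _ _).trans (by simp)
  · exact (MvPolynomial.totalDegree_mul _ _).trans (by simp)

theorem det_ne_zero (f : Flag Ω) : f.dirU 0 * f.dirV 1 - f.dirU 1 * f.dirV 0 ≠ 0 := by
  have key : ∀ U V : Plane, LinearIndependent ℝ ![U, V] → U 0 * V 1 - U 1 * V 0 ≠ 0 := by
    intro U V h hD
    rw [LinearIndependent.pair_iff] at h
    have h1 := h (V 1) (-U 1) (by ext i; fin_cases i <;> simp <;> linarith)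
    have h2 := h (V 0) (-U 0) (by ext i; fin_cases i <;> simp <;> linarith)
    have h3 := h 1 0 (by
      ext i
      fin_cases i
      · simpa using h2.2
      · simpa using h1.2)
    exact one_ne_zero h3.1
  obtain ⟨x, i, b⟩ := f
  cases b
  · intro h
    refine key _ _ ((Ω x).nondegenerate i) ?_
    change ((Ω x).vert (i - 1) - (Ω x).vert i) 0 * ((Ω x).vert (i + 1) - (Ω x).vert i) 1 -
      ((Ω x).vert (i - 1) - (Ω x).vert i) 1 * ((Ω x).vert (i + 1) - (Ω x).vert i) 0 = 0 at h
    linarith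
  · exact key _ _ ((Ω x).nondegenerate i)

/-- The expression of a polynomial in the standard coordinates of a flag as a polynomial on the
plane. -/
def globalExpr (f : Flag Ω) : MvPolynomial (Fin 2) ℝ →ₐ[ℝ] MvPolynomial (Fin 2) ℝ :=
  MvPolynomial.aeval fun i =>
    MvPolynomial.C ((f.dirU 0 * f.dirV 1 - f.dirU 1 * f.dirV 0)⁻¹ *
        ![f.dirV 1, -f.dirU 1] i) * (MvPolynomial.X 0 - MvPolynomial.C (f.base 0)) +
      MvPolynomial.C ((f.dirU 0 * f.dirV 1 - f.dirU 1 * f.dirV 0)⁻¹ *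
        ![-f.dirV 0, f.dirU 0] i) * (MvPolynomial.X 1 - MvPolynomial.C (f.base 1))

theorem totalDegree_globalExpr_le (f : Flag Ω) (g : MvPolynomial (Fin 2) ℝ) :
    (f.globalExpr g).totalDegree ≤ g.totalDegree := by
  refine totalDegree_aeval_le _ (fun i => ?_) g
  have h : ∀ (c d : ℝ) (j : Fin 2), (MvPolynomial.C c * (MvPolynomial.X j - MvPolynomial.C d) :
      MvPolynomial (Fin 2) ℝ).totalDegree ≤ 1 := by
    intro c d j
    refine (MvPolynomial.totalDegree_mul _ _).trans ?_
    rw [MvPolynomial.totalDegree_C, zero_add]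
    exact (MvPolynomial.totalDegree_sub _ _).trans (by simp)
  exact (MvPolynomial.totalDegree_add _ _).trans (max_le (h _ _ _) (h _ _ _))

theorem localExpr_globalExpr (f : Flag Ω) (g : MvPolynomial (Fin 2) ℝ) :
    f.localExpr (f.globalExpr g) = g := by
  have hD := f.det_ne_zero
  suffices h : f.localExpr.comp f.globalExpr = AlgHom.id ℝ _ from DFunLike.congr_fun h g
  ext1 i
  have hC : ∀ r : ℝ, f.localExpr (MvPolynomial.C r) = MvPolynomial.C r := MvPolynomial.algHom_C _
  rw [AlgHom.comp_apply, globalExpr, MvPolynomial.aeval_X]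
  simp only [map_add, map_mul, map_sub, hC, localExpr_X, AlgHom.id_apply]
  fin_cases i
  · have h1 : (MvPolynomial.C ((f.dirU 0 * f.dirV 1 - f.dirU 1 * f.dirV 0)⁻¹ *
        (f.dirU 0 * f.dirV 1 - f.dirU 1 * f.dirV 0)) : MvPolynomial (Fin 2) ℝ) = 1 := by
      rw [inv_mul_cancel₀ hD, map_one]
    simp only [map_mul, map_sub] at h1
    simp only [Fin.zero_eta, Matrix.cons_val_zero, map_neg]
    linear_combination (MvPolynomial.X 0) * h1
  · have h1 : (MvPolynomial.C ((f.dirU 0 * f.dirV 1 - f.dirU 1 * f.dirV 0)⁻¹ *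
        (f.dirU 0 * f.dirV 1 - f.dirU 1 * f.dirV 0)) : MvPolynomial (Fin 2) ℝ) = 1 := by
      rw [inv_mul_cancel₀ hD, map_one]
    simp only [map_mul, map_sub] at h1
    simp only [Fin.mk_one, Matrix.cons_val_one, Matrix.cons_val_fin_one, map_neg]
    linear_combination (MvPolynomial.X 1) * h1

theorem globalExpr_localExpr (f : Flag Ω) (g : MvPolynomial (Fin 2) ℝ) :
    f.globalExpr (f.localExpr g) = g := by
  have hD := f.det_ne_zero
  suffices h : f.globalExpr.comp f.localExpr = AlgHom.id ℝ _ from DFunLike.congr_fun h g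
  ext1 i
  have hC : ∀ r : ℝ, f.globalExpr (MvPolynomial.C r) = MvPolynomial.C r :=
    MvPolynomial.algHom_C _
  have h1 : (MvPolynomial.C ((f.dirU 0 * f.dirV 1 - f.dirU 1 * f.dirV 0)⁻¹ *
      (f.dirU 0 * f.dirV 1 - f.dirU 1 * f.dirV 0)) : MvPolynomial (Fin 2) ℝ) = 1 := by
    rw [inv_mul_cancel₀ hD, map_one]
  rw [AlgHom.comp_apply, localExpr_X]
  simp only [map_add, map_mul, hC, AlgHom.id_apply]
  simp only [globalExpr, MvPolynomial.aeval_X]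
  simp only [map_mul, map_sub] at h1
  simp only [map_mul, Matrix.cons_val_zero, Matrix.cons_val_one, Matrix.cons_val_fin_one, map_neg]
  fin_cases i
  · simp only [Fin.zero_eta]
    linear_combination (MvPolynomial.X 0 - MvPolynomial.C (f.base 0)) * h1
  · simp only [Fin.mk_one]
    linear_combination (MvPolynomial.X 1 - MvPolynomial.C (f.base 1)) * h1

theorem localExpr_opp (f : Flag Ω) (g : MvPolynomial (Fin 2) ℝ) :
    f.opp.localExpr g = MvPolynomial.aeval ![MvPolynomial.X 1, MvPolynomial.X 0]
      (f.localExpr g) := by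
  rw [← AlgHom.comp_apply]
  congr 1
  ext1 i
  rw [AlgHom.comp_apply, localExpr_X, localExpr_X]
  simp [MvPolynomial.algHom_C]
  ring

theorem localExpr_rev (f : Flag Ω) (hf : f.shape = Shape.rectangle)
    (g : MvPolynomial (Fin 2) ℝ) :
    f.rev.localExpr g = MvPolynomial.aeval ![1 - MvPolynomial.X 0, MvPolynomial.X 1]
      (f.localExpr g) := by
  rw [← AlgHom.comp_apply]
  congr 1
  ext1 i
  rw [AlgHom.comp_apply, localExpr_X, localExpr_X, base_rev, dirU_rev, dirV_rev, hf]
  simp [MvPolynomial.algHom_C, Shape.r]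
  ring

theorem localExpr_opp_mem (f : Flag Ω) {k : ℕ} {g : MvPolynomial (Fin 2) ℝ}
    (h : f.localExpr g ∈ MvPolynomial.restrictDegree (Fin 2) ℝ k) :
    f.opp.localExpr g ∈ MvPolynomial.restrictDegree (Fin 2) ℝ k := by
  rw [mem_restrictDegree_iff_degreeOf] at h ⊢
  intro i
  rw [localExpr_opp]
  refine (degreeOf_aeval_le _ i (1 - i) (fun j => ?_) _).trans (h _)
  fin_cases i <;> fin_cases j <;> simp [MvPolynomial.degreeOf_X_of_ne]

theorem localExpr_rev_mem (f : Flag Ω) (hf : f.shape = Shape.rectangle) {k : ℕ}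
    {g : MvPolynomial (Fin 2) ℝ}
    (h : f.localExpr g ∈ MvPolynomial.restrictDegree (Fin 2) ℝ k) :
    f.rev.localExpr g ∈ MvPolynomial.restrictDegree (Fin 2) ℝ k := by
  rw [mem_restrictDegree_iff_degreeOf] at h ⊢
  intro i
  rw [localExpr_rev f hf]
  refine (degreeOf_aeval_le _ i i (fun j => ?_) _).trans (h _)
  have h1 : ∀ i j : Fin 2, (1 - MvPolynomial.X j : MvPolynomial (Fin 2) ℝ).degreeOf i ≤
      (MvPolynomial.X j : MvPolynomial (Fin 2) ℝ).degreeOf i := fun i j =>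
    (MvPolynomial.degreeOf_sub_le _ _ _).trans (by simp)
  have h2 : (1 - MvPolynomial.X 0 : MvPolynomial (Fin 2) ℝ).degreeOf 1 = 0 :=
    Nat.le_zero.mp ((h1 1 0).trans (by simp [MvPolynomial.degreeOf_X_of_ne]))
  have h3 : (1 - MvPolynomial.X 0 : MvPolynomial (Fin 2) ℝ).degreeOf 0 ≤ 1 :=
    (h1 0 0).trans (by simp)
  fin_cases i <;> fin_cases j <;> simp [MvPolynomial.degreeOf_X_of_ne, h2, h3]

/-- Swaps and reflections preserve bidegree at most (k, k), and reversing the edge and then taking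
the opposite one moves to the next corner, so one corner controls all flags. -/
theorem localExpr_mem_of_base {x : K₀} (hx : (Ω x).shape = Shape.rectangle) {k : ℕ}
    {g : MvPolynomial (Fin 2) ℝ}
    (h : (⟨x, 0, true⟩ : Flag Ω).localExpr g ∈ MvPolynomial.restrictDegree (Fin 2) ℝ k)
    (f : Flag Ω) (hf : f.face = x) :
    f.localExpr g ∈ MvPolynomial.restrictDegree (Fin 2) ℝ k := by
  obtain ⟨x', i, b⟩ := f
  obtain rfl : x' = x := hf
  have e1 : ∀ i, (⟨x', i + 1, true⟩ : Flag Ω) = (⟨x', i, true⟩ : Flag Ω).rev.opp := fun _ => rfl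
  have e2 : ∀ i, (⟨x', i, false⟩ : Flag Ω) = (⟨x', i, true⟩ : Flag Ω).opp := fun _ => rfl
  have hi : (⟨x', i, true⟩ : Flag Ω).localExpr g ∈ MvPolynomial.restrictDegree (Fin 2) ℝ k := by
    induction i using fin_induction with
    | h0 => exact h
    | hs i ih =>
      rw [e1]
      exact localExpr_opp_mem _ (localExpr_rev_mem ⟨x', i, true⟩ hx ih)
  cases b
  · rw [e2]
    exact localExpr_opp_mem _ hi
  · exact hi

end Flag

/-! ## The dimension of the space of all polynomial families -/

/-- Polynomials of degree at most `k` on a triangle, of bidegree at most `(k, k)` on a rectangle,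
in standard coordinates. -/
def Shape.polys (k : ℕ) : Shape → Submodule ℝ (MvPolynomial (Fin 2) ℝ)
  | .triangle => MvPolynomial.restrictTotalDegree (Fin 2) ℝ k
  | .rectangle => MvPolynomial.restrictDegree (Fin 2) ℝ k

instance (k : ℕ) (s : Shape) : FiniteDimensional ℝ (s.polys k) := by
  cases s
  · exact inferInstanceAs (FiniteDimensional ℝ (MvPolynomial.restrictTotalDegree (Fin 2) ℝ k))
  · exact inferInstanceAs (FiniteDimensional ℝ (MvPolynomial.restrictDegree (Fin 2) ℝ k))

theorem Shape.totalDegree_le_of_mem_polys {k : ℕ} {s : Shape} (hs : s = Shape.triangle)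
    {p : MvPolynomial (Fin 2) ℝ} (hp : p ∈ s.polys k) : p.totalDegree ≤ k := by
  subst hs
  exact (MvPolynomial.mem_restrictTotalDegree _ _ _).mp hp

theorem Shape.mem_restrictDegree_of_mem_polys {k : ℕ} {s : Shape} (hs : s = Shape.rectangle)
    {p : MvPolynomial (Fin 2) ℝ} (hp : p ∈ s.polys k) :
    p ∈ MvPolynomial.restrictDegree (Fin 2) ℝ k := by
  subst hs
  exact hp

namespace Surface

variable {K₀ K₁ : Type*} (M : Surface K₀ K₁)

theorem localExpr_mem_polys {k : ℕ} {g : K₀ → MvPolynomial (Fin 2) ℝ} (hg : g ∈ M.degreeLE k)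
    (f : Flag M.Ω) : f.localExpr (g f.face) ∈ f.shape.polys k := by
  obtain ⟨h1, h2⟩ := hg f.face
  cases hs : f.shape
  · exact (MvPolynomial.mem_restrictTotalDegree _ _ _).mpr
      ((f.totalDegree_localExpr_le _).trans (h1 hs))
  · exact h2 hs f rfl

/-- Polynomial families in standard coordinates of the polygons. -/
def degreeLEEquiv (k : ℕ) : M.degreeLE k ≃ₗ[ℝ] ((x : K₀) → (M.Ω x).shape.polys k) where
  toFun g x := ⟨(⟨x, 0, true⟩ : Flag M.Ω).localExpr (g.1 x), M.localExpr_mem_polys g.2 ⟨x, 0, true⟩⟩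
  map_add' g h := by
    ext x : 2
    simp
  map_smul' r g := by
    ext x : 2
    simp
  invFun p := ⟨fun x => (⟨x, 0, true⟩ : Flag M.Ω).globalExpr (p x).1, fun x => by
    have hp := (p x).2
    refine ⟨fun hx => ?_, fun hx f hf => ?_⟩
    · exact (Flag.totalDegree_globalExpr_le _ _).trans
        (Shape.totalDegree_le_of_mem_polys hx hp)
    · refine Flag.localExpr_mem_of_base hx ?_ f hf
      rw [Flag.localExpr_globalExpr]
      exact Shape.mem_restrictDegree_of_mem_polys hx hp⟩
  left_inv g := by
    ext x : 2
    simp [Flag.globalExpr_localExpr]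
  right_inv p := by
    ext x : 2
    simp [Flag.localExpr_globalExpr]

instance [Finite K₀] (k : ℕ) : FiniteDimensional ℝ (M.degreeLE k) :=
  Module.Finite.equiv (M.degreeLEEquiv k).symm

/-- The weight is arbitrary because it serves twice: for dimensions and for numbers of sides. -/
theorem sum_shape [Fintype K₀] (φ : Shape → ℕ) :
    ∑ x, φ (M.Ω x).shape = M.numTri * φ .triangle + M.numRect * φ .rectangle := by
  classical
  have hdec : ∀ s : Shape, Nat.card {x : K₀ // (M.Ω x).shape = s} =
      (Finset.univ.filter fun x => (M.Ω x).shape = s).card := fun s => by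
    rw [Nat.card_eq_fintype_card, Fintype.card_subtype]
  rw [numTri, numRect, hdec, hdec, ← smul_eq_mul, ← smul_eq_mul, ← Finset.sum_const,
    ← Finset.sum_const, Finset.sum_filter, Finset.sum_filter, ← Finset.sum_add_distrib]
  refine Finset.sum_congr rfl fun x _ => ?_
  cases (M.Ω x).shape <;> simp

theorem finrank_degreeLE [Fintype K₀] (k : ℕ) :
    Module.finrank ℝ (M.degreeLE k) * 2 =
      M.numTri * ((k + 1) * (k + 2)) + M.numRect * (2 * (k + 1) ^ 2) := by
  rw [(M.degreeLEEquiv k).finrank_eq, Module.finrank_pi_fintype, Finset.sum_mul]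
  have h := M.sum_shape (fun s => Module.finrank ℝ (s.polys k) * 2)
  have h1 : Module.finrank ℝ (Shape.triangle.polys k) * 2 = (k + 1) * (k + 2) :=
    finrank_restrictTotalDegree k
  have h2 : Module.finrank ℝ (Shape.rectangle.polys k) = (k + 1) ^ 2 := finrank_restrictDegree k
  rw [h1, h2, mul_comm _ 2] at h
  exact h

end Surface

namespace GluingPoly

/-! ## Regularity and degrees of gluing data -/

/-- The functions `β`, `γ` have no poles on the edge, and `γ < 0` there. -/
def Regular (D : GluingPoly) : Prop :=
  ∀ u ∈ Set.Icc (0 : ℝ) 1, D.a.eval u ≠ 0 ∧ D.gamma u < 0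

theorem Regular.swap {D : GluingPoly} (h : D.Regular) : D.swap.Regular := by
  intro u hu
  obtain ⟨ha, hg⟩ := h u hu
  have hc : D.c.eval u ≠ 0 := by
    intro hc
    simp [gamma, hc] at hg
  refine ⟨hc, ?_⟩
  have : D.swap.gamma u = (D.gamma u)⁻¹ := by simp [GluingPoly.swap, gamma]
  rw [this]
  exact inv_lt_zero.mpr hg

theorem Regular.reverse {D : GluingPoly} (h : D.Regular) (s₁ s₂ : Shape) :
    (D.reverse s₁ s₂).Regular := by
  intro u hu
  have := h (1 - u) ⟨by linarith [hu.2], by linarith [hu.1]⟩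
  simpa [GluingPoly.reverse, gamma] using this

theorem Regular.a_ne {D : GluingPoly} (h : D.Regular) : D.a.eval 0 ≠ 0 :=
  (h 0 (by simp)).1

theorem Regular.gamma_neg {D : GluingPoly} (h : D.Regular) : D.gamma 0 < 0 :=
  (h 0 (by simp)).2

/-- Degree bounds for gluing data, in which the first and the second polygon contribute
symmetrically. -/
structure DegreeBound (D : GluingPoly) (s₁ s₂ : Shape) (δ : ℕ) : Prop where
  a_le : s₁.r + D.a.natDegree ≤ δ
  b_le : D.b.natDegree ≤ δ
  c_le : s₂.r + D.c.natDegree ≤ δ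

theorem DegreeBound.swap {D : GluingPoly} {s₁ s₂ : Shape} {δ : ℕ} (h : D.DegreeBound s₁ s₂ δ) :
    D.swap.DegreeBound s₂ s₁ δ :=
  ⟨h.c_le, by simpa [GluingPoly.swap] using h.b_le, h.a_le⟩

theorem natDegree_comp_one_sub (p : ℝ[X]) : (p.comp (1 - Polynomial.X)).natDegree = p.natDegree := by
  have : (1 - Polynomial.X : ℝ[X]).natDegree = 1 := by
    rw [← Polynomial.natDegree_neg, neg_sub, ← Polynomial.C_1, Polynomial.natDegree_X_sub_C]
  rw [Polynomial.natDegree_comp, this, mul_one]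

/-- The reversed b is a combination of a, b and c, all of degree at most δ. Hence the same δ works
in every reading of the edge. -/
theorem DegreeBound.reverse {D : GluingPoly} {s₁ s₂ : Shape} {δ : ℕ} (h : D.DegreeBound s₁ s₂ δ) :
    (D.reverse s₁ s₂).DegreeBound s₁ s₂ δ := by
  refine ⟨?_, ?_, ?_⟩
  · simpa [GluingPoly.reverse, natDegree_comp_one_sub] using h.a_le
  · simp only [GluingPoly.reverse, natDegree_comp_one_sub]
    have ha : D.a.natDegree ≤ δ := (Nat.le_add_left _ _).trans h.a_le
    have hc : D.c.natDegree ≤ δ := (Nat.le_add_left _ _).trans h.c_le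
    have h1 := Polynomial.natDegree_sub_le_of_le (Polynomial.natDegree_sub_le_of_le
      ((Polynomial.natDegree_C_mul_le (1 - (s₁.r : ℝ)) _).trans ha)
      ((Polynomial.natDegree_C_mul_le (1 - (s₂.r : ℝ)) _).trans hc)) h.b_le
    simpa using h1
  · simpa [GluingPoly.reverse, natDegree_comp_one_sub] using h.c_le

theorem deriv_div_eval (p q : ℝ[X]) (hq : q.eval 0 ≠ 0) :
    deriv (fun u => p.eval u / q.eval u) 0 =
      ((Polynomial.derivative p).eval 0 * q.eval 0 - p.eval 0 * (Polynomial.derivative q).eval 0) /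
        q.eval 0 ^ 2 :=
  ((p.hasDerivAt 0).div (q.hasDerivAt 0) hq).deriv

theorem deriv_beta {D : GluingPoly} (h : D.a.eval 0 ≠ 0) : deriv D.beta 0 =
    ((Polynomial.derivative D.b).eval 0 * D.a.eval 0 -
      D.b.eval 0 * (Polynomial.derivative D.a).eval 0) / D.a.eval 0 ^ 2 :=
  deriv_div_eval _ _ h

theorem deriv_gamma {D : GluingPoly} (h : D.a.eval 0 ≠ 0) : deriv D.gamma 0 =
    ((Polynomial.derivative D.c).eval 0 * D.a.eval 0 -
      D.c.eval 0 * (Polynomial.derivative D.a).eval 0) / D.a.eval 0 ^ 2 :=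
  deriv_div_eval _ _ h

/-! ## Errors along glued edges -/

/-- The errors along an edge, read from the second polygon to the first one. -/
def swapErr (D : GluingPoly) : ℝ[X] × ℝ[X] →ₗ[ℝ] ℝ[X] × ℝ[X] where
  -- The swapped second error is b ∂g₁/∂u₁ + c ∂g₂/∂v₂ − a ∂g₁/∂v₁. Trading ∂g₁/∂u₁ for ∂g₂/∂u₂
  -- costs the derivative of the first error.
  toFun e := (-e.1, D.b * Polynomial.derivative e.1 - e.2)
  map_add' e e' := by
    ext1 <;> simp <;> ring
  map_smul' r e := by
    ext1 <;> simp [smul_sub]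

/-- The errors along an edge, read from the other end-point. -/
def revErr (D : GluingPoly) (s₁ : Shape) : ℝ[X] × ℝ[X] →ₗ[ℝ] ℝ[X] × ℝ[X] where
  -- The corrections from `dvP_rev` and from the reversed b cancel, up to (1 − r₁) a (∂g₁/∂u₁ −
  -- ∂g₂/∂u₂).
  toFun e := (e.1.comp (1 - Polynomial.X),
    (e.2 - Polynomial.C (1 - (s₁.r : ℝ)) * D.a * Polynomial.derivative e.1).comp
      (1 - Polynomial.X))
  map_add' e e' := by
    ext1 <;> simp
    ring
  map_smul' r e := by
    ext1 <;> simp [smul_sub]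

/-- The matrix that expresses the derivatives `∂/∂u_k, ∂/∂v_k, ∂²/∂u_k∂v_k` through the previous
ones around a vertex, up to a multiple of `β(0)`. -/
def jetMatrix (D : GluingPoly) : Matrix (Fin 3) (Fin 3) ℝ :=
  !![0, 1, 0; D.gamma 0, D.beta 0, 0; deriv D.gamma 0, deriv D.beta 0, D.gamma 0]

/-- A functional of the errors at the starting point of an edge, with the coefficient `c.1` of the
value and the coefficients `c.2` of the derivatives `∂/∂u, ∂/∂v, ∂²/∂u∂v`. -/
def jetErr (D : GluingPoly) : ℝ × (Fin 3 → ℝ) →ₗ[ℝ] Module.Dual ℝ (ℝ[X] × ℝ[X]) :=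
  -- The last two terms are the value and, by the quotient rule, the derivative at 0 of e₂/a, the
  -- deviation from the relation with β and γ themselves.
  LinearMap.mk₂ ℝ (fun c e => c.1 * e.1.eval 0 + c.2 0 * (Polynomial.derivative e.1).eval 0
      + c.2 1 * (e.2.eval 0 / D.a.eval 0)
      + c.2 2 * (((Polynomial.derivative e.2).eval 0 * D.a.eval 0 -
        e.2.eval 0 * (Polynomial.derivative D.a).eval 0) / D.a.eval 0 ^ 2))
    (fun _ _ _ => by simp; ring) (fun _ _ _ => by simp; ring)
    (fun _ _ _ => by simp; ring) (fun _ _ _ => by simp; ring)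

theorem jetErr_apply (D : GluingPoly) (c : ℝ × (Fin 3 → ℝ)) (e : ℝ[X] × ℝ[X]) :
    D.jetErr c e = c.1 * e.1.eval 0 + c.2 0 * (Polynomial.derivative e.1).eval 0
      + c.2 1 * (e.2.eval 0 / D.a.eval 0)
      + c.2 2 * (((Polynomial.derivative e.2).eval 0 * D.a.eval 0 -
        e.2.eval 0 * (Polynomial.derivative D.a).eval 0) / D.a.eval 0 ^ 2) := rfl

end GluingPoly

namespace Flag

variable {K₀ : Type*} {Ω : K₀ → Polygon}

/-- The deviations of a polynomial family from the two `G¹` conditions along a glued edge. -/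
def err (f f' : Flag Ω) (D : GluingPoly) :
    (K₀ → MvPolynomial (Fin 2) ℝ) →ₗ[ℝ] ℝ[X] × ℝ[X] where
  toFun g := (f.valP (g f.face) - f'.valP (g f'.face),
    D.a * f.dvP (g f.face) - D.b * f'.duP (g f'.face) - D.c * f'.dvP (g f'.face))
  map_add' g h := by
    ext1
    · simp
      ring
    · simp
      ring
  map_smul' r g := by
    ext1 <;> simp [smul_sub]

theorem err_swap (f f' : Flag Ω) (D : GluingPoly) (g : K₀ → MvPolynomial (Fin 2) ℝ) :
    err f' f D.swap g = D.swapErr (err f f' D g) := by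
  ext1
  · simp [err, GluingPoly.swapErr]
  · simp [err, GluingPoly.swapErr, GluingPoly.swap, duP_apply]
    ring

theorem err_rev (f f' : Flag Ω) (D : GluingPoly) (g : K₀ → MvPolynomial (Fin 2) ℝ) :
    err f.rev f'.rev (D.reverse f.shape f'.shape) g = D.revErr f.shape (err f f' D g) := by
  have e : f.rev.face = f.face := rfl
  have e' : f'.rev.face = f'.face := rfl
  ext1
  · simp [err, GluingPoly.revErr, valP_rev, e, e']
  · simp [err, GluingPoly.revErr, dvP_rev, duP_rev, GluingPoly.reverse, e, e']
    simp [duP_apply]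
    ring

/-- A functional of the first derivatives and of the mixed derivative at the vertex of a flag. -/
def jet (f : Flag Ω) (c : ℝ × (Fin 3 → ℝ)) (g : K₀ → MvPolynomial (Fin 2) ℝ) : ℝ :=
  c.1 * (f.valP (g f.face)).eval 0 + c.2 0 * (f.duP (g f.face)).eval 0 +
    c.2 1 * (f.dvP (g f.face)).eval 0 +
    c.2 2 * (Polynomial.derivative (f.dvP (g f.face))).eval 0

/-- Differentiating ∂g₁/∂v₁ = β ∂g₂/∂u₂ + γ ∂g₂/∂v₂ along the edge produces the pure second
derivative β(0) ∂²g₂/∂u₂², which `jetMatrix` cannot express. The hypothesis `hc` removes this term.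
-/
theorem jetErr_err (f f' : Flag Ω) (D : GluingPoly) (ha : D.a.eval 0 ≠ 0)
    (c : ℝ × (Fin 3 → ℝ)) (hc : c.2 2 = 0 ∨ D.b.eval 0 = 0)
    (g : K₀ → MvPolynomial (Fin 2) ℝ) :
    D.jetErr c (err f f'.opp D g) =
      f.jet c g - f'.jet (c.1, Matrix.vecMul c.2 D.jetMatrix) g := by
  have e : f'.opp.face = f'.face := rfl
  obtain ⟨c0, r⟩ := c
  have hd := eval_mixed_opp f' (g f'.face)
  rw [GluingPoly.jetErr_apply, jet, jet]
  simp only [err, LinearMap.coe_mk, AddHom.coe_mk, e, Polynomial.eval_sub, Polynomial.eval_mul,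
    Polynomial.derivative_sub, Polynomial.derivative_mul, Polynomial.eval_add,
    eval_valP_opp, eval_duP_opp, eval_dvP_opp, hd, GluingPoly.jetMatrix, Matrix.vecMul, dotProduct,
    Fin.sum_univ_three, GluingPoly.deriv_beta ha, GluingPoly.deriv_gamma ha, GluingPoly.beta,
    GluingPoly.gamma, ← duP_apply, Matrix.of_apply, Matrix.cons_val_zero, Matrix.cons_val_one,
    Matrix.cons_val]
  rcases hc with hc | hc
  · simp only at hc
    rw [hc]
    field_simp
    ring
  · rw [hc]
    field_simp
    ring

end Flag

namespace PreSurface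

variable {K₀ K₁ : Type*} (M : PreSurface K₀ K₁)

/-! ## Half-edges -/

/-- The flag on the side `s` of the gluing `k`, starting at the end-point `e`. -/
def half (k : K₁) (e s : Bool) : Flag M.Ω :=
  bif e then (bif s then M.tgt k else M.src k).rev else bif s then M.tgt k else M.src k

/-- The gluing data from the side `s` to the other one, in standard coordinates that start at the
end-point `e`. -/
def halfData (k : K₁) (e s : Bool) : GluingPoly :=
  bif s then
    (bif e then (M.data k).reverse (M.src k).shape (M.tgt k).shape else M.data k).swap
  else bif e then (M.data k).reverse (M.src k).shape (M.tgt k).shape else M.data k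

theorem glued_half (k : K₁) (e s : Bool) :
    M.Glued (M.half k e s) (M.half k e !s) (M.halfData k e s) := by
  cases e <;> cases s
  · exact .direct k
  · exact .inverse k
  · exact .directRev k
  · exact .inverseRev k

theorem Glued.exists_half {f f' : Flag M.Ω} {D : GluingPoly} (h : M.Glued f f' D) :
    ∃ k e s, f = M.half k e s ∧ f' = M.half k e !s ∧ D = M.halfData k e s := by
  cases h with
  | direct k => exact ⟨k, false, false, rfl, rfl, rfl⟩
  | inverse k => exact ⟨k, false, true, rfl, rfl, rfl⟩
  | directRev k => exact ⟨k, true, false, rfl, rfl, rfl⟩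
  | inverseRev k => exact ⟨k, true, true, rfl, rfl, rfl⟩

theorem regular_data (k : K₁) : (M.data k).Regular :=
  fun u hu => ⟨M.a_ne_zero k u hu, M.gamma_neg k u hu⟩

theorem regular_halfData (k : K₁) (e s : Bool) : (M.halfData k e s).Regular := by
  cases e <;> cases s
  · exact M.regular_data k
  · exact (M.regular_data k).swap
  · exact (M.regular_data k).reverse _ _
  · exact ((M.regular_data k).reverse _ _).swap

theorem half_shape (k : K₁) (e s : Bool) :
    (M.half k e s).shape = bif s then (M.tgt k).shape else (M.src k).shape := by
  cases e <;> cases s <;> rfl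

theorem degreeBound_halfData {δ : ℕ} (k : K₁)
    (h : (M.data k).DegreeBound (M.src k).shape (M.tgt k).shape δ) (e s : Bool) :
    (M.halfData k e s).DegreeBound (M.half k e s).shape (M.half k e !s).shape δ := by
  cases e <;> cases s
  · exact h
  · exact h.swap
  · exact h.reverse
  · exact h.reverse.swap

/-- The value of `b` at the other end-point of the edge, in the coordinates that start there. -/
theorem halfData_not_b_eval (k : K₁) (e s : Bool) :
    (M.halfData k (!e) s).b.eval 0 =
      (1 - ((M.half k e s).shape.r : ℝ)) * (M.halfData k e s).a.eval 1 -
      (1 - ((M.half k e !s).shape.r : ℝ)) * (M.halfData k e s).c.eval 1 -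
      (M.halfData k e s).b.eval 1 := by
  simp only [half_shape]
  cases e <;> cases s <;>
    simp [halfData, GluingPoly.reverse, GluingPoly.swap] <;> ring

theorem halfData_not_side_b_eval (k : K₁) (e s : Bool) :
    (M.halfData k e (!s)).b.eval 0 = -(M.halfData k e s).b.eval 0 := by
  cases e <;> cases s <;> simp [halfData, GluingPoly.reverse, GluingPoly.swap]

/-- The deviations from the `G¹` conditions along all glued edges. -/
def errMap : (K₀ → MvPolynomial (Fin 2) ℝ) →ₗ[ℝ] K₁ → ℝ[X] × ℝ[X] :=
  LinearMap.pi fun k => Flag.err (M.src k) (M.tgt k) (M.data k)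

/-- The errors along the edge `k`, read from the side `s` and from the end-point `e`. -/
def halfErr (k : K₁) (e s : Bool) : ℝ[X] × ℝ[X] →ₗ[ℝ] ℝ[X] × ℝ[X] :=
  bif s then (M.halfData k e false).swapErr ∘ₗ
    (bif e then (M.data k).revErr (M.src k).shape else LinearMap.id)
  else bif e then (M.data k).revErr (M.src k).shape else LinearMap.id

theorem halfErr_errMap (k : K₁) (e s : Bool) (g : K₀ → MvPolynomial (Fin 2) ℝ) :
    M.halfErr k e s (M.errMap g k) =
      Flag.err (M.half k e s) (M.half k e !s) (M.halfData k e s) g := by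
  cases e <;> cases s
  · rfl
  · exact (Flag.err_swap _ _ _ _).symm
  · exact (Flag.err_rev _ _ _ _).symm
  · refine Eq.trans ?_ (Flag.err_swap _ _ _ _).symm
    exact congrArg ((M.data k).reverse (M.src k).shape (M.tgt k).shape).swapErr
      (Flag.err_rev (M.src k) (M.tgt k) (M.data k) g).symm

/-- An edge error of the second kind with a given reading from the half-edge `(e, s)`. -/
def unread (e s : Bool) (t : ℝ[X]) : ℝ[X] :=
  (bif s then (-1 : ℝ) else 1) • bif e then t.comp (1 - Polynomial.X) else t

theorem comp_one_sub_comp (t : ℝ[X]) :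
    (t.comp (1 - Polynomial.X)).comp (1 - Polynomial.X) = t := by
  rw [Polynomial.comp_assoc]
  simp

theorem halfErr_unread (k : K₁) (e s : Bool) (t : ℝ[X]) :
    M.halfErr k e s (0, unread e s t) = (0, t) := by
  cases e <;> cases s <;>
    simp [halfErr, unread, GluingPoly.swapErr, GluingPoly.revErr, comp_one_sub_comp]

/-- The sign is irrelevant. What matters is that a zero of `t` at 1 becomes a zero of the same order
at the start of the other reading. -/
theorem halfErr_not_unread (k : K₁) (e s s' : Bool) (t : ℝ[X]) :
    ∃ σ : ℝ, M.halfErr k (!e) s' (0, unread e s t) = (0, σ • t.comp (1 - Polynomial.X)) := by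
  refine ⟨if s = s' then 1 else -1, ?_⟩
  cases e <;> cases s <;> cases s' <;>
    simp [halfErr, unread, GluingPoly.swapErr, GluingPoly.revErr]

theorem halfErr_unread_fst (k : K₁) (e s : Bool) (t : ℝ[X]) :
    (M.halfErr k e s (unread e s t, 0)).1 = t := by
  cases e <;> cases s <;>
    simp [halfErr, unread, GluingPoly.swapErr, GluingPoly.revErr, comp_one_sub_comp]

theorem halfErr_not_unread_fst (k : K₁) (e s s' : Bool) (t : ℝ[X]) :
    ∃ σ : ℝ, (M.halfErr k (!e) s' (unread e s t, 0)).1 = σ • t.comp (1 - Polynomial.X) := by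
  refine ⟨if s = s' then 1 else -1, ?_⟩
  cases e <;> cases s <;> cases s' <;>
    simp [halfErr, unread, GluingPoly.swapErr, GluingPoly.revErr]

end PreSurface

namespace Flag

variable {K₀ : Type*} {Ω : K₀ → Polygon}

/-- A flag is an edge with an orientation. -/
def edgeEquiv : Flag Ω ≃ PolyEdge Ω × Bool where
  toFun f := (f.edge, f.forward)
  invFun p := ⟨p.1.1, if p.2 then p.1.2 else p.1.2 + 1, p.2⟩
  left_inv f := by
    obtain ⟨x, i, b⟩ := f
    cases b
    · exact congrArg (fun j => (⟨x, j, false⟩ : Flag Ω)) (sub_add_cancel i 1)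
    · rfl
  right_inv p := by
    obtain ⟨⟨x, i⟩, b⟩ := p
    cases b
    · exact congrArg (fun j => ((⟨x, j⟩, false) : PolyEdge Ω × Bool)) (add_sub_cancel_right i 1)
    · rfl

instance [Finite K₀] : Finite (Flag Ω) := Finite.of_equiv _ edgeEquiv.symm

theorem eq_or_eq_rev {f f' : Flag Ω} (h : f.edge = f'.edge) : f = f' ∨ f = f'.rev := by
  by_cases hb : f.forward = f'.forward
  · exact Or.inl (edgeEquiv.injective (Prod.ext h hb))
  · refine Or.inr (edgeEquiv.injective (Prod.ext (h.trans f'.rev_edge.symm) ?_))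
    change f.forward = !f'.forward
    revert hb
    cases f.forward <;> cases f'.forward <;> simp

end Flag

namespace PreSurface

variable {K₀ K₁ : Type*} (M : PreSurface K₀ K₁)

/-! ## Walking around vertices -/

theorem half_edge (k : K₁) (e s : Bool) : (M.half k e s).edge =
    Sum.elim (fun k => (M.src k).edge) (fun k => (M.tgt k).edge)
      (bif s then Sum.inr k else Sum.inl k : K₁ ⊕ K₁) := by
  cases e <;> cases s <;> simp [half]

/-- The edge determines the gluing and the side by `edges_injective`; the two ends differ by
`Flag.rev_ne`. This makes `partner` well defined. -/
theorem half_injective {k k' : K₁} {e e' s s' : Bool} (h : M.half k e s = M.half k' e' s') :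
    k = k' ∧ e = e' ∧ s = s' := by
  have h1 := congrArg Flag.edge h
  rw [half_edge, half_edge] at h1
  have h2 := M.edges_injective h1
  have h3 : k = k' ∧ s = s' := by
    revert h2
    cases s <;> cases s' <;> simp
  obtain ⟨rfl, rfl⟩ := h3
  refine ⟨rfl, ?_, rfl⟩
  revert h
  cases e <;> cases e' <;> simp [half, Flag.rev_ne, (Flag.rev_ne _).symm]

theorem exists_half {f : Flag M.Ω} (hf : ¬ M.IsBoundaryEdge f.edge) :
    ∃ k e s, f = M.half k e s := by
  simp only [IsBoundaryEdge, not_forall, not_and_or, not_not] at hf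
  obtain ⟨k, h | h⟩ := hf
  · rcases Flag.eq_or_eq_rev h.symm with h | h
    · exact ⟨k, false, false, h⟩
    · exact ⟨k, true, false, h⟩
  · rcases Flag.eq_or_eq_rev h.symm with h | h
    · exact ⟨k, false, true, h⟩
    · exact ⟨k, true, true, h⟩

theorem not_isBoundaryEdge_half (k : K₁) (e s : Bool) :
    ¬ M.IsBoundaryEdge (M.half k e s).edge := by
  intro h
  have := h k
  rw [half_edge] at this
  cases s <;> simp at this

open Classical in
/-- The flag to which a given flag is glued. A flag on the boundary is its own partner. -/
def partner (f : Flag M.Ω) : Flag M.Ω :=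
  if h : ∃ p : K₁ × Bool × Bool, f = M.half p.1 p.2.1 p.2.2 then
    M.half h.choose.1 h.choose.2.1 !h.choose.2.2
  else f

theorem partner_half (k : K₁) (e s : Bool) : M.partner (M.half k e s) = M.half k e !s := by
  have h : ∃ p : K₁ × Bool × Bool, M.half k e s = M.half p.1 p.2.1 p.2.2 := ⟨(k, e, s), rfl⟩
  rw [partner, dif_pos h]
  obtain ⟨h1, h2, h3⟩ := M.half_injective h.choose_spec
  rw [← h1, ← h2, ← h3]

theorem partner_of_boundary {f : Flag M.Ω} (hf : M.IsBoundaryEdge f.edge) : M.partner f = f := by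
  rw [partner, dif_neg]
  rintro ⟨p, rfl⟩
  exact M.not_isBoundaryEdge_half _ _ _ hf

@[simp] theorem partner_partner (f : Flag M.Ω) : M.partner (M.partner f) = f := by
  by_cases hf : M.IsBoundaryEdge f.edge
  · rw [M.partner_of_boundary hf, M.partner_of_boundary hf]
  · obtain ⟨k, e, s, rfl⟩ := M.exists_half hf
    rw [partner_half, partner_half, Bool.not_not]

theorem partner_eq_self_iff (f : Flag M.Ω) : M.partner f = f ↔ M.IsBoundaryEdge f.edge := by
  refine ⟨fun h => ?_, M.partner_of_boundary⟩
  by_contra hf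
  obtain ⟨k, e, s, rfl⟩ := M.exists_half hf
  rw [partner_half] at h
  have := (M.half_injective h).2.2
  revert this
  cases s <;> simp

variable {M}

theorem Glued.partner_eq {f f' : Flag M.Ω} {D : GluingPoly} (h : M.Glued f f' D) :
    M.partner f = f' := by
  obtain ⟨k, e, s, rfl, rfl, rfl⟩ := h.exists_half
  exact M.partner_half k e s

theorem Glued.partner_ne {f f' : Flag M.Ω} {D : GluingPoly} (h : M.Glued f f' D) :
    M.partner f ≠ f := by
  obtain ⟨k, e, s, rfl, rfl, rfl⟩ := h.exists_half
  rw [Ne, partner_eq_self_iff]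
  exact M.not_isBoundaryEdge_half _ _ _

variable (M)

theorem vertexOf_partner (f : Flag M.Ω) :
    M.vertexOf (M.partner f).corner = M.vertexOf f.corner := by
  by_cases hf : M.IsBoundaryEdge f.edge
  · rw [M.partner_of_boundary hf]
  · obtain ⟨k, e, s, rfl⟩ := M.exists_half hf
    rw [partner_half]
    exact (Quot.sound ⟨_, _, _, M.glued_half k e s, rfl, rfl⟩).symm

/-- The next flag around the vertex. -/
def turn (f : Flag M.Ω) : Flag M.Ω := M.partner f.opp

theorem turn_injective : Function.Injective M.turn := by
  intro f f' h
  have := congrArg (fun x => (M.partner x).opp) h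
  simpa [turn] using this

theorem vertexOf_turn (f : Flag M.Ω) : M.vertexOf (M.turn f).corner = M.vertexOf f.corner :=
  M.vertexOf_partner _

/-- A flag and its opposite are on one orbit of `turn` only if the orbit meets the boundary. -/
theorem exists_partner_eq_of_opp_iterate (d : ℕ) (f : Flag M.Ω)
    (h : (M.turn^[d] f).opp = f) : ∃ m, M.partner (M.turn^[m] f) = M.turn^[m] f := by
  induction d using Nat.twoStepInduction generalizing f with
  | zero => exact absurd h (Flag.opp_ne f)
  | one =>
    refine ⟨1, ?_⟩
    simp only [Function.iterate_one] at h ⊢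
    have h1 : M.turn f = f.opp := by rw [← h, Flag.opp_opp, h]
    conv_lhs => rw [turn, partner_partner]
    exact h1.symm
  | more d ih _ =>
    -- `opp` reverses the walk: `turn ∘ opp ∘ turn = opp`. Hence one step can be removed at each
    -- end, which lowers the length by two.
    have h1 : M.turn (M.turn^[d + 2] f).opp = (M.turn^[d + 1] f).opp := by
      rw [Function.iterate_succ_apply']
      simp [turn]
    rw [h, Function.iterate_succ_apply] at h1
    obtain ⟨m, hm⟩ := ih (M.turn f) h1.symm
    exact ⟨m + 1, hm⟩

variable {M}

theorem IsInteriorStar.turn_eq {n : ℕ} {f : ℕ → Flag M.Ω} {D : ℕ → GluingPoly}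
    (h : M.IsInteriorStar n f D) {k : ℕ} (hk : k < n) : f (k + 1) = M.turn (f k) := by
  rw [turn, ← (h.glued k hk).partner_eq, partner_partner]

theorem IsInteriorStar.iterate_eq {n : ℕ} {f : ℕ → Flag M.Ω} {D : ℕ → GluingPoly}
    (h : M.IsInteriorStar n f D) {k d : ℕ} (hk : k + d ≤ n) : f (k + d) = M.turn^[d] (f k) := by
  induction d with
  | zero => rfl
  | succ d ih =>
    rw [Function.iterate_succ_apply', ← ih (by omega), ← h.turn_eq (by omega)]
    rfl

theorem IsInteriorStar.exists_iterate_eq {n : ℕ} {f : ℕ → Flag M.Ω} {D : ℕ → GluingPoly}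
    (h : M.IsInteriorStar n f D) {k : ℕ} (hk : k ≤ n) (m : ℕ) :
    ∃ j < n, M.turn^[m] (f k) = f (j + 1) := by
  have hn := h.pos
  induction m with
  | zero =>
    rcases k with _ | k
    · refine ⟨n - 1, by omega, ?_⟩
      rw [Nat.sub_add_cancel hn]
      exact h.cyclic
    · exact ⟨k, hk, rfl⟩
  | succ m ih =>
    obtain ⟨j, hj, e⟩ := ih
    rw [Function.iterate_succ_apply', e]
    by_cases hj' : j + 1 < n
    · exact ⟨j + 1, hj', (h.turn_eq hj').symm⟩
    · have : j + 1 = n := by omega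
      refine ⟨0, hn, ?_⟩
      rw [this, ← h.cyclic, ← h.turn_eq hn]

/-- Meeting a flag and its opposite would force the walk to turn back at a boundary edge, but all
edges of the star are glued. So no star passes an edge end from both sides. -/
theorem IsInteriorStar.ne_opp {n : ℕ} {f : ℕ → Flag M.Ω} {D : ℕ → GluingPoly}
    (h : M.IsInteriorStar n f D) {i j : ℕ} (hi : i ≤ n) (hj : j ≤ n) : f i ≠ (f j).opp := by
  have key : ∀ i d : ℕ, i + d ≤ n → (f (i + d)).opp ≠ f i := by
    intro i d hd he
    rw [h.iterate_eq hd] at he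
    obtain ⟨m, hm⟩ := M.exists_partner_eq_of_opp_iterate d _ he
    obtain ⟨j, hj, e⟩ := h.exists_iterate_eq (k := i) (by omega) m
    rw [e] at hm
    exact (h.glued j hj).partner_ne hm
  intro he
  rcases le_total i j with hij | hij
  · obtain ⟨d, rfl⟩ := Nat.exists_eq_add_of_le hij
    exact key i d hj he.symm
  · obtain ⟨d, rfl⟩ := Nat.exists_eq_add_of_le hij
    exact key j d hi (by rw [he, Flag.opp_opp])

theorem IsInteriorStar.vertexOf_eq {n : ℕ} {f : ℕ → Flag M.Ω} {D : ℕ → GluingPoly}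
    (h : M.IsInteriorStar n f D) {k : ℕ} (hk : k ≤ n) :
    M.vertexOf (f k).corner = M.vertexOf (f 1).corner := by
  have h0 : ∀ k, k ≤ n → M.vertexOf (f k).corner = M.vertexOf (f 0).corner := by
    intro k hk
    induction k with
    | zero => rfl
    | succ k ih => rw [h.turn_eq hk, vertexOf_turn, ih (by omega)]
  rw [h0 k hk, h0 1 h.pos]

variable (M)

/-- A vertex all of whose edges are glued. -/
def IsInterior (P : M.Vertex) : Prop :=
  ∃ n f D, M.IsInteriorStar n f D ∧ M.vertexOf (f 1).corner = P

/-- `turn` is injective on a finite set, hence every flag is periodic, and one minimal period is a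
star. -/
theorem isInterior_of_forall [Finite K₀] (P : M.Vertex)
    (hP : ∀ f : Flag M.Ω, M.vertexOf f.corner = P → ¬ M.IsBoundaryEdge f.edge) :
    M.IsInterior P := by
  obtain ⟨⟨x, i⟩, rfl⟩ := Quot.exists_rep P
  set f₀ : Flag M.Ω := ⟨x, i, true⟩
  have hv : ∀ j, M.vertexOf (M.turn^[j] f₀).corner = M.vertexOf ⟨x, i⟩ := by
    intro j
    induction j with
    | zero => rfl
    | succ j ih => rw [Function.iterate_succ_apply', vertexOf_turn, ih]
  have hglue : ∀ j, ∃ D, M.Glued (M.turn^[j + 1] f₀) (M.turn^[j] f₀).opp D := by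
    intro j
    obtain ⟨k, e, s, h⟩ := M.exists_half (hP _ (hv (j + 1)))
    refine ⟨M.halfData k e s, ?_⟩
    have h' : (M.turn^[j] f₀).opp = M.partner (M.turn^[j + 1] f₀) := by
      rw [Function.iterate_succ_apply', turn, partner_partner]
    rw [h', h, partner_half]
    exact M.glued_half k e s
  choose D hD using hglue
  have hper : f₀ ∈ Function.periodicPts M.turn :=
    M.turn_injective.mem_periodicPts f₀
  refine ⟨Function.minimalPeriod M.turn f₀, fun j => M.turn^[j] f₀, fun j => D (j - 1),
    ⟨Function.minimalPeriod_pos_of_mem_periodicPts hper, ?_, ?_, ?_⟩, hv 1⟩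
  · intro i hi j hj hij
    obtain ⟨i, rfl⟩ : ∃ i', i = i' + 1 := ⟨i - 1, by have := hi.1; omega⟩
    obtain ⟨j, rfl⟩ : ∃ j', j = j' + 1 := ⟨j - 1, by have := hj.1; omega⟩
    simp only [Function.iterate_succ_apply'] at hij
    have := Function.iterate_injOn_Iio_minimalPeriod (f := M.turn) (x := f₀) hi.2 hj.2
      (M.turn_injective hij)
    rw [this]
  · exact (Function.isPeriodicPt_minimalPeriod M.turn f₀).symm
  · intro j _
    exact hD j

end PreSurface

/-! ### Parity of fixed points of involutions -/

theorem two_dvd_card_ne_of_involutive {α : Type*} [Fintype α] [DecidableEq α] {φ : α → α}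
    (hφ : Function.Involutive φ) : 2 ∣ (Finset.univ.filter fun x => φ x ≠ x).card := by
  have h := Equiv.Perm.two_dvd_card_support (σ := hφ.toPerm) (by
    ext x
    simp [pow_two, hφ x])
  convert h using 2
  ext x
  simp

/-- If an involution and a fixed point free involution act on a finite set, then the former cannot
have exactly one fixed point. -/
theorem exists_ne_fixed {α : Type*} [Finite α] {φ ψ : α → α}
    (hφ : Function.Involutive φ) (hψ : Function.Involutive ψ) (hψ' : ∀ x, ψ x ≠ x)
    (x : α) (hx : φ x = x) : ∃ y, y ≠ x ∧ φ y = y := by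
  classical
  have := Fintype.ofFinite α
  by_contra! h
  have h1 := two_dvd_card_ne_of_involutive hφ
  have h2 := two_dvd_card_ne_of_involutive hψ
  have e1 : (Finset.univ.filter fun y => φ y ≠ y) = Finset.univ.erase x := by
    ext y
    simp only [Finset.mem_filter, Finset.mem_univ, true_and, Finset.mem_erase, and_true]
    exact ⟨fun hy hxy => hy (hxy ▸ hx), fun hy => h y hy⟩
  have e2 : (Finset.univ.filter fun y => ψ y ≠ y) = Finset.univ := by
    ext y
    simp [hψ']
  -- Both the cardinality and its predecessor would be even.
  rw [e1, Finset.card_erase_of_mem (Finset.mem_univ x)] at h1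
  rw [e2] at h2
  have : 0 < (Finset.univ : Finset α).card := Finset.card_pos.mpr ⟨x, Finset.mem_univ x⟩
  omega

namespace PreSurface

variable {K₀ K₁ : Type*} (M : PreSurface K₀ K₁)

/-! ## Counting -/

/-- On the flags at `P`, `opp` is a fixed point free involution and `partner` is one that fixes
exactly the boundary flags. There is one boundary flag, hence a second one. -/
theorem exists_boundary_pair [Finite K₀] (P : M.Vertex) (hP : ¬ M.IsInterior P) :
    ∃ f : Bool → Flag M.Ω, f false ≠ f true ∧
      ∀ b, M.vertexOf (f b).corner = P ∧ M.IsBoundaryEdge (f b).edge := by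
  have h1 := mt (M.isInterior_of_forall P) hP
  push Not at h1
  obtain ⟨f, hf, hb⟩ := h1
  let α := {f : Flag M.Ω // M.vertexOf f.corner = P}
  let φ : α → α := fun f => ⟨M.partner f.1, (M.vertexOf_partner f.1).trans f.2⟩
  let ψ : α → α := fun f => ⟨f.1.opp, f.2⟩
  obtain ⟨y, hy, hy'⟩ := exists_ne_fixed (φ := φ) (ψ := ψ) (fun f => Subtype.ext (by simp [φ]))
    (fun f => Subtype.ext (by simp [ψ])) (fun f h => f.1.opp_ne (congrArg Subtype.val h))
    ⟨f, hf⟩ (Subtype.ext (M.partner_of_boundary hb))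
  refine ⟨fun b => bif b then f else y.1, fun h => hy (Subtype.ext h), fun b => ?_⟩
  cases b
  · exact ⟨y.2, (M.partner_eq_self_iff _).mp (congrArg Subtype.val hy')⟩
  · exact ⟨hf, hb⟩

instance [Finite K₀] : Finite M.Vertex :=
  inferInstanceAs (Finite (Quot _))

/-- Each such vertex has at least two boundary flags, and each boundary edge carries two flags in
all. -/
theorem card_not_isInterior_le [Finite K₀] :
    Nat.card {P : M.Vertex // ¬ M.IsInterior P} ≤
      Nat.card {e : PolyEdge M.Ω // M.IsBoundaryEdge e} := by
  choose f hne hf using fun P : {P : M.Vertex // ¬ M.IsInterior P} =>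
    M.exists_boundary_pair P.1 P.2
  have hinj : Function.Injective (fun p : {P : M.Vertex // ¬ M.IsInterior P} × Bool =>
      ((⟨(f p.1 p.2).edge, (hf p.1 p.2).2⟩, (f p.1 p.2).forward) :
        {e : PolyEdge M.Ω // M.IsBoundaryEdge e} × Bool)) := by
    rintro ⟨P, b⟩ ⟨Q, c⟩ h
    simp only [Prod.mk.injEq, Subtype.mk.injEq] at h
    have h1 : f P b = f Q c := Flag.edgeEquiv.injective (Prod.ext h.1 h.2)
    have h2 : P = Q := Subtype.ext (by rw [← (hf P b).1, ← (hf Q c).1, h1])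
    subst h2
    have h3 := hne P
    revert h1
    cases b <;> cases c <;> simp [h3, h3.symm]
  have := Nat.card_le_card_of_injective _ hinj
  rw [Nat.card_prod, Nat.card_prod] at this
  simpa using this

theorem card_vertex_le [Finite K₀] :
    Nat.card M.Vertex ≤ Nat.card {P : M.Vertex // M.IsInterior P} +
      Nat.card {e : PolyEdge M.Ω // M.IsBoundaryEdge e} := by
  classical
  have h := Nat.card_congr (Equiv.sumCompl M.IsInterior)
  rw [Nat.card_sum] at h
  rw [← h]
  exact Nat.add_le_add_left M.card_not_isInterior_le _

theorem card_polyEdge [Fintype K₀] [Fintype K₁] :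
    ∑ x, (M.Ω x).shape.sides =
      2 * Fintype.card K₁ + Nat.card {e : PolyEdge M.Ω // M.IsBoundaryEdge e} := by
  classical
  have h := Nat.card_congr (Equiv.sumCompl M.IsBoundaryEdge)
  rw [Nat.card_sum] at h
  have h1 : Nat.card {e // ¬ M.IsBoundaryEdge e} = 2 * Fintype.card K₁ := by
    have e : K₁ ⊕ K₁ ≃ {e // ¬ M.IsBoundaryEdge e} := by
      refine (Equiv.ofInjective _ M.edges_injective).trans (Equiv.subtypeEquivRight fun e => ?_)
      simp only [Set.mem_range, Sum.exists, Sum.elim_inl, Sum.elim_inr, IsBoundaryEdge, not_forall,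
        not_and_or, not_not, exists_or]
    rw [← Nat.card_congr e]
    simp [two_mul]
  rw [h1] at h
  rw [add_comm, h]
  simp

end PreSurface

/-! ## Transport of jets around a vertex -/

/-- The product of the first `k` jet matrices around a vertex. -/
def jetProd (D : ℕ → GluingPoly) : ℕ → Matrix (Fin 3) (Fin 3) ℝ
  | 0 => 1
  | k + 1 => (D (k + 1)).jetMatrix * jetProd D k

theorem det_jetMatrix (D : GluingPoly) : D.jetMatrix.det = -(D.gamma 0 * D.gamma 0) := by
  simp [GluingPoly.jetMatrix, Matrix.det_fin_three]

theorem isUnit_det_jetMatrix {D : GluingPoly} (h : D.Regular) : IsUnit D.jetMatrix.det := by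
  rw [det_jetMatrix, isUnit_iff_ne_zero]
  exact neg_ne_zero.mpr (mul_self_ne_zero.mpr h.gamma_neg.ne)

theorem isUnit_det_jetProd {D : ℕ → GluingPoly} {n : ℕ} (h : ∀ k < n, (D (k + 1)).Regular) :
    IsUnit (jetProd D n).det := by
  induction n with
  | zero => simp [jetProd]
  | succ n ih =>
    rw [jetProd, Matrix.det_mul]
    exact (isUnit_det_jetMatrix (h n (by omega))).mul (ih fun k hk => h k (by omega))

/-- The jet matrices are block lower triangular with the tangent matrices as upper left blocks. So a
row without mixed component is transported by tangent matrices alone. -/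
theorem jetProd_tangentProd (D : ℕ → GluingPoly) (n : ℕ) :
    (jetProd D n 0 0 = tangentProd D n 0 0 ∧ jetProd D n 0 1 = tangentProd D n 0 1 ∧
      jetProd D n 0 2 = 0) ∧
    (jetProd D n 1 0 = tangentProd D n 1 0 ∧ jetProd D n 1 1 = tangentProd D n 1 1 ∧
      jetProd D n 1 2 = 0) := by
  induction n with
  | zero => simp [jetProd, tangentProd]
  | succ n ih =>
    obtain ⟨⟨h1, h2, h3⟩, h4, h5, h6⟩ := ih
    simp [jetProd, tangentProd, GluingPoly.jetMatrix, GluingPoly.tangentMatrix, Matrix.mul_apply,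
      Fin.sum_univ_three, Fin.sum_univ_two, h1, h2, h3, h4, h5, h6]

theorem vecMul_jetProd_of_tangentProd_eq_one {D : ℕ → GluingPoly} {n : ℕ}
    (h : tangentProd D n = 1) {r : Fin 3 → ℝ} (hr : r 2 = 0) :
    Matrix.vecMul r (jetProd D n) = r := by
  obtain ⟨⟨h1, h2, h3⟩, h4, h5, h6⟩ := jetProd_tangentProd D n
  rw [h] at h1 h2 h4 h5
  ext i
  fin_cases i <;>
    simp [Matrix.vecMul, dotProduct, Fin.sum_univ_three, h1, h2, h3, h4, h5, h6, hr]

/-- With β = 0 the tangent cycle says γ₁γ₃ = γ₂γ₄ = 1. The two differential restrictions then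
express that the first two entries of the last row vanish. -/
theorem jetProd_four_eq_one {D : ℕ → GluingPoly} (h : tangentProd D 4 = 1)
    (hb : ∀ k ∈ Finset.Icc 1 4, (D k).beta 0 = 0)
    (h1 : deriv (D 1).beta 0 + deriv (D 2).gamma 0 / (D 2).gamma 0 =
        -(D 1).gamma 0 * (deriv (D 3).beta 0 + deriv (D 4).gamma 0 / (D 4).gamma 0))
    (h2 : deriv (D 2).beta 0 + deriv (D 3).gamma 0 / (D 3).gamma 0 =
        -(D 2).gamma 0 * (deriv (D 4).beta 0 + deriv (D 1).gamma 0 / (D 1).gamma 0)) :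
    jetProd D 4 = 1 := by
  have b1 := hb 1 (by simp)
  have b2 := hb 2 (by simp)
  have b3 := hb 3 (by simp)
  have b4 := hb 4 (by simp)
  have e1 := congrFun (congrFun h 0) 0
  have e2 := congrFun (congrFun h 1) 1
  simp [tangentProd, GluingPoly.tangentMatrix, Matrix.mul_apply, Fin.sum_univ_two, b1, b2, b3,
    b4] at e1 e2
  have i1 : ((D 1).gamma 0)⁻¹ = (D 3).gamma 0 := inv_eq_of_mul_eq_one_left e1
  have i2 : ((D 2).gamma 0)⁻¹ = (D 4).gamma 0 := inv_eq_of_mul_eq_one_left e2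
  have i3 : ((D 3).gamma 0)⁻¹ = (D 1).gamma 0 := inv_eq_of_mul_eq_one_right e1
  have i4 : ((D 4).gamma 0)⁻¹ = (D 2).gamma 0 := inv_eq_of_mul_eq_one_right e2
  rw [div_eq_mul_inv, div_eq_mul_inv, i2, i4] at h1
  rw [div_eq_mul_inv, div_eq_mul_inv, i1, i3] at h2
  ext i j
  fin_cases i <;> fin_cases j <;>
    simp [jetProd, GluingPoly.jetMatrix, Matrix.mul_apply, Fin.sum_univ_three, b1, b2, b3, b4]
  · linear_combination e1
  · linear_combination e2
  · linear_combination (D 4).gamma 0 * h2 + (deriv (D 4).beta 0 + (D 4).gamma 0 *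
      deriv (D 2).beta 0) * e1 - deriv (D 4).beta 0 * e2
  · linear_combination (D 3).gamma 0 * h1 - deriv (D 4).gamma 0 * (D 2).gamma 0 * e1 +
      deriv (D 3).beta 0 * (e2 - e1) + (D 3).gamma 0 * deriv (D 1).beta 0 * e2
  · linear_combination e1 + (D 3).gamma 0 * (D 1).gamma 0 * e2

namespace Surface

variable {K₀ K₁ : Type*} (M : Surface K₀ K₁)

/-! ## Relations between the errors around interior vertices -/

/-- A crossing vertex. -/
def IsCrossing (P : M.Vertex) : Prop :=
  ∃ f D, M.IsCrossingStar f D ∧ M.vertexOf (f 1).corner = P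

theorem IsCrossing.isInterior {P : M.Vertex} (h : M.IsCrossing P) : M.IsInterior P := by
  obtain ⟨f, D, h, hP⟩ := h
  exact ⟨4, f, D, h.1, hP⟩

abbrev InteriorVertex := {P : M.Vertex // M.IsInterior P}

/-- A crossing vertex is required to have some crossing star, so the star chosen there has to be
one. -/
theorem exists_star (P : M.InteriorVertex) :
    ∃ S : ℕ × (ℕ → Flag M.Ω) × (ℕ → GluingPoly), M.IsInteriorStar S.1 S.2.1 S.2.2 ∧
      M.vertexOf (S.2.1 1).corner = P ∧
      (M.IsCrossing P → S.1 = 4 ∧ ∀ k ∈ Finset.Icc 1 4, (S.2.2 k).beta 0 = 0) := by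
  by_cases h : M.IsCrossing P
  · obtain ⟨f, D, h, hP⟩ := h
    exact ⟨(4, f, D), h.1, hP, fun _ => ⟨rfl, h.2⟩⟩
  · obtain ⟨n, f, D, h', hP⟩ := P.2
    exact ⟨(n, f, D), h', hP, fun h'' => absurd h'' h⟩

/-- The number of corners in the chosen star around an interior vertex. -/
def starLen (P : M.InteriorVertex) : ℕ := (M.exists_star P).choose.1

/-- The flags of the chosen star around an interior vertex. -/
def starFlag (P : M.InteriorVertex) : ℕ → Flag M.Ω := (M.exists_star P).choose.2.1

/-- The gluing data of the chosen star around an interior vertex. -/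
def starData (P : M.InteriorVertex) : ℕ → GluingPoly := (M.exists_star P).choose.2.2

theorem isInteriorStar (P : M.InteriorVertex) :
    M.IsInteriorStar (M.starLen P) (M.starFlag P) (M.starData P) :=
  (M.exists_star P).choose_spec.1

theorem vertexOf_starFlag (P : M.InteriorVertex) {j : ℕ} (hj : j ≤ M.starLen P) :
    M.vertexOf (M.starFlag P j).corner = P :=
  ((M.isInteriorStar P).vertexOf_eq hj).trans (M.exists_star P).choose_spec.2.1

theorem starLen_of_isCrossing {P : M.InteriorVertex} (h : M.IsCrossing P) : M.starLen P = 4 :=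
  ((M.exists_star P).choose_spec.2.2 h).1

theorem beta_of_isCrossing {P : M.InteriorVertex} (h : M.IsCrossing P) :
    ∀ k ∈ Finset.Icc 1 4, (M.starData P k).beta 0 = 0 :=
  ((M.exists_star P).choose_spec.2.2 h).2

theorem regular_starData (P : M.InteriorVertex) {j : ℕ} (hj : j < M.starLen P) :
    (M.starData P (j + 1)).Regular := by
  obtain ⟨k, e, s, -, -, h⟩ := ((M.isInteriorStar P).glued j hj).exists_half
  rw [h]
  exact M.regular_halfData k e s

theorem jetProd_eq_one_of_isCrossing {P : M.InteriorVertex} (h : M.IsCrossing P) :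
    jetProd (M.starData P) 4 = 1 := by
  have hs : M.IsInteriorStar 4 (M.starFlag P) (M.starData P) := by
    rw [← M.starLen_of_isCrossing h]
    exact M.isInteriorStar P
  have hb := M.beta_of_isCrossing h
  have hc := M.crossing _ _ ⟨hs, hb⟩
  exact jetProd_four_eq_one (M.tangent_cycle _ _ _ hs) hb hc.1 hc.2

/-- The parameters of the relations: three for each interior vertex and one more for each crossing
vertex. -/
abbrev RelParam := (M.InteriorVertex × Fin 3) ⊕ {P : M.Vertex // M.IsCrossing P} → ℝ

open Classical in
/-- The parameter of the mixed derivative: it vanishes unless the vertex is crossing. -/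
def mixedParam (P : M.InteriorVertex) : M.RelParam →ₗ[ℝ] ℝ :=
  if h : M.IsCrossing P then LinearMap.proj (Sum.inr ⟨P.1, h⟩) else 0

/-- The coefficients of the value and of the derivatives at the first corner of a star. -/
def initialCoef (P : M.InteriorVertex) : M.RelParam →ₗ[ℝ] ℝ × (Fin 3 → ℝ) :=
  (LinearMap.proj (Sum.inl (P, 0))).prod (LinearMap.pi
    ![LinearMap.proj (Sum.inl (P, 1)), LinearMap.proj (Sum.inl (P, 2)), M.mixedParam P])

/-- The coefficients of the value and of the derivatives at the corners of a star. -/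
def coef (P : M.InteriorVertex) (j : ℕ) : M.RelParam →ₗ[ℝ] ℝ × (Fin 3 → ℝ) :=
  -- The inverse product solves the backward recursion `coef_step`. The value coefficient stays
  -- constant.
  (LinearMap.prodMap LinearMap.id (Matrix.vecMulLinear (jetProd (M.starData P) j)⁻¹)) ∘ₗ
    M.initialCoef P

theorem coef_fst (P : M.InteriorVertex) (j : ℕ) (u : M.RelParam) :
    (M.coef P j u).1 = u (Sum.inl (P, 0)) := rfl

theorem coef_snd (P : M.InteriorVertex) (j : ℕ) (u : M.RelParam) :
    (M.coef P j u).2 =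
      Matrix.vecMul (M.initialCoef P u).2 (jetProd (M.starData P) j)⁻¹ := rfl

theorem coef_zero (P : M.InteriorVertex) (u : M.RelParam) :
    M.coef P 0 u = M.initialCoef P u := by
  ext1
  · rfl
  · rw [coef_snd]
    simp [jetProd]

theorem coef_step (P : M.InteriorVertex) {j : ℕ} (hj : j < M.starLen P) (u : M.RelParam) :
    Matrix.vecMul (M.coef P (j + 1) u).2 (M.starData P (j + 1)).jetMatrix =
      (M.coef P j u).2 := by
  rw [coef_snd, coef_snd, Matrix.vecMul_vecMul, jetProd, Matrix.mul_inv_rev, Matrix.mul_assoc,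
    Matrix.nonsing_inv_mul _ (isUnit_det_jetMatrix (M.regular_starData P hj)), Matrix.mul_one]

/-- The monodromy fixes the initial row: at a crossing vertex it is the identity, elsewhere the
mixed component is zero and the tangent cycle suffices. -/
theorem coef_last (P : M.InteriorVertex) (u : M.RelParam) :
    M.coef P (M.starLen P) u = M.coef P 0 u := by
  rw [coef_zero]
  ext1
  · rfl
  · have hdet := isUnit_det_jetProd (D := M.starData P) (n := M.starLen P)
      fun k hk => M.regular_starData P hk
    have h : Matrix.vecMul (M.initialCoef P u).2 (jetProd (M.starData P) (M.starLen P)) =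
        (M.initialCoef P u).2 := by
      by_cases hc : M.IsCrossing P
      · rw [M.starLen_of_isCrossing hc, M.jetProd_eq_one_of_isCrossing hc, Matrix.vecMul_one]
      · refine vecMul_jetProd_of_tangentProd_eq_one
          (M.tangent_cycle _ _ _ (M.isInteriorStar P)) ?_
        simp [initialCoef, mixedParam, hc]
    rw [coef_snd]
    conv_lhs => rw [← h]
    rw [Matrix.vecMul_vecMul, Matrix.mul_nonsing_inv _ hdet, Matrix.vecMul_one]

/-- The last column of `jetMatrix` is (0, 0, γ(0)). As γ(0) ≠ 0, the mixed coefficient vanishes at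
all corners of a star or at none. -/
theorem coef_mixed_step (P : M.InteriorVertex) {j : ℕ} (hj : j < M.starLen P)
    (u : M.RelParam) : (M.coef P j u).2 2 =
      (M.starData P (j + 1)).gamma 0 * (M.coef P (j + 1) u).2 2 := by
  rw [← M.coef_step P hj]
  simp [Matrix.vecMul, dotProduct, Fin.sum_univ_three, GluingPoly.jetMatrix, mul_comm]

theorem coef_mixed_eq_zero_iff (P : M.InteriorVertex) {j : ℕ} (hj : j ≤ M.starLen P)
    (u : M.RelParam) : (M.coef P j u).2 2 = 0 ↔ M.mixedParam P u = 0 := by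
  induction j with
  | zero =>
    rw [coef_zero]
    rfl
  | succ j ih =>
    have hj' : j < M.starLen P := hj
    rw [← ih hj'.le, M.coef_mixed_step P hj']
    have := (M.regular_starData P hj').gamma_neg.ne
    simp [this]

theorem isCrossing_of_mixedParam_ne {P : M.InteriorVertex} {u : M.RelParam}
    (h : M.mixedParam P u ≠ 0) : M.IsCrossing P := by
  by_contra hc
  simp [mixedParam, hc] at h

/-- A position in one of the chosen stars. -/
abbrev Position := Σ P : M.InteriorVertex, Fin (M.starLen P)

theorem exists_positionHalf (p : M.Position) : ∃ h : K₁ × Bool × Bool,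
    M.starFlag p.1 (p.2 + 1) = M.half h.1 h.2.1 h.2.2 ∧
    (M.starFlag p.1 p.2).opp = M.half h.1 h.2.1 !h.2.2 ∧
    M.starData p.1 (p.2 + 1) = M.halfData h.1 h.2.1 h.2.2 := by
  obtain ⟨k, e, s, h⟩ := ((M.isInteriorStar p.1).glued p.2 p.2.2).exists_half
  exact ⟨(k, e, s), h⟩

/-- The glued edge at a position in a star. -/
def posEdge (p : M.Position) : K₁ := (M.exists_positionHalf p).choose.1

/-- The end-point of the glued edge at a position in a star. -/
def posEnd (p : M.Position) : Bool := (M.exists_positionHalf p).choose.2.1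

/-- The side of the glued edge at a position in a star. -/
def posSide (p : M.Position) : Bool := (M.exists_positionHalf p).choose.2.2

theorem starFlag_succ (p : M.Position) :
    M.starFlag p.1 (p.2 + 1) = M.half (M.posEdge p) (M.posEnd p) (M.posSide p) :=
  (M.exists_positionHalf p).choose_spec.1

theorem starFlag_opp (p : M.Position) :
    (M.starFlag p.1 p.2).opp = M.half (M.posEdge p) (M.posEnd p) !(M.posSide p) :=
  (M.exists_positionHalf p).choose_spec.2.1

theorem starData_succ (p : M.Position) :
    M.starData p.1 (p.2 + 1) = M.halfData (M.posEdge p) (M.posEnd p) (M.posSide p) :=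
  (M.exists_positionHalf p).choose_spec.2.2

/-- Each end of a glued edge occurs at most once in the stars. -/
theorem position_eq {p q : M.Position} (hk : M.posEdge p = M.posEdge q)
    (he : M.posEnd p = M.posEnd q) : p = q := by
  obtain ⟨P, i⟩ := p
  obtain ⟨Q, j⟩ := q
  have hp := M.starFlag_succ ⟨P, i⟩
  have hP := M.vertexOf_starFlag P i.2
  by_cases hs : M.posSide ⟨P, i⟩ = M.posSide ⟨Q, j⟩
  · have hq := M.starFlag_succ ⟨Q, j⟩
    rw [← hk, ← he, ← hs, ← hp] at hq
    dsimp only at hq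
    have hQ := M.vertexOf_starFlag Q j.2
    have e : P = Q := by
      rw [Subtype.ext_iff, ← hP, ← hQ]
      exact congrArg (fun f => M.vertexOf (Flag.corner f)) hq.symm
    subst e
    have := (M.isInteriorStar P).injOn ⟨by omega, i.2⟩ ⟨by omega, j.2⟩ hq.symm
    have : i = j := Fin.ext (by omega)
    rw [this]
  -- Opposite sides of one edge end would put a flag and an opposite flag into one star.
  · exfalso
    have hs' : M.posSide ⟨P, i⟩ = !M.posSide ⟨Q, j⟩ := by
      revert hs
      cases M.posSide ⟨P, i⟩ <;> cases M.posSide ⟨Q, j⟩ <;> simp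
    have hq := M.starFlag_opp ⟨Q, j⟩
    rw [← hk, ← he, ← hs', ← hp] at hq
    dsimp only at hq
    have hQ := M.vertexOf_starFlag Q j.2.le
    have e : P = Q := by
      rw [Subtype.ext_iff, ← hP, ← hQ, ← Flag.opp_corner (M.starFlag Q j)]
      exact congrArg (fun f => M.vertexOf (Flag.corner f)) hq.symm
    subst e
    exact (M.isInteriorStar P).ne_opp (Nat.succ_le_of_lt i.2) j.2.le hq.symm

instance [Finite K₀] : Fintype M.InteriorVertex := Fintype.ofFinite _

/-- The relation between the errors along the glued edges with given parameters. -/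
def relation [Finite K₀] : M.RelParam →ₗ[ℝ] Module.Dual ℝ (K₁ → ℝ[X] × ℝ[X]) :=
  ∑ p : M.Position, LinearMap.dualMap
    (M.halfErr (M.posEdge p) (M.posEnd p) (M.posSide p) ∘ₗ LinearMap.proj (M.posEdge p)) ∘ₗ
      (M.starData p.1 (p.2 + 1)).jetErr ∘ₗ M.coef p.1 (p.2 + 1)

theorem relation_apply [Finite K₀] (u : M.RelParam) (w : K₁ → ℝ[X] × ℝ[X]) :
    M.relation u w = ∑ p : M.Position,
      (M.starData p.1 (p.2 + 1)).jetErr (M.coef p.1 (p.2 + 1) u)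
        (M.halfErr (M.posEdge p) (M.posEnd p) (M.posSide p) (w (M.posEdge p))) := by
  simp [relation, LinearMap.sum_apply]

/-- For each vertex the sum telescopes, and the two extreme terms agree since the flags and the
coefficients both close up. -/
theorem relation_errMap [Finite K₀] (u : M.RelParam) (g : K₀ → MvPolynomial (Fin 2) ℝ) :
    M.relation u (M.errMap g) = 0 := by
  rw [relation_apply, Fintype.sum_sigma]
  refine Finset.sum_eq_zero fun P _ => ?_
  have key : ∀ j : Fin (M.starLen P), (M.starData P (j + 1)).jetErr (M.coef P (j + 1) u)
        (M.halfErr (M.posEdge ⟨P, j⟩) (M.posEnd ⟨P, j⟩) (M.posSide ⟨P, j⟩)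
          (M.errMap g (M.posEdge ⟨P, j⟩))) =
      (M.starFlag P (j + 1)).jet (M.coef P (j + 1) u) g -
        (M.starFlag P j).jet (M.coef P j u) g := by
    intro j
    rw [PreSurface.halfErr_errMap, ← M.starFlag_succ ⟨P, j⟩, ← M.starFlag_opp ⟨P, j⟩,
      ← M.starData_succ ⟨P, j⟩]
    have ha := (M.regular_starData P j.2).a_ne
    rw [Flag.jetErr_err _ _ _ ha, M.coef_step P j.2]
    · rfl
    · by_cases h : M.mixedParam P u = 0
      · exact Or.inl ((M.coef_mixed_eq_zero_iff P j.2 u).mpr h)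
      · have hc := M.isCrossing_of_mixedParam_ne h
        have hj : (j : ℕ) < 4 := j.2.trans_eq (M.starLen_of_isCrossing hc)
        have hb := M.beta_of_isCrossing hc (j + 1) (by simp; omega)
        exact Or.inr ((div_eq_zero_iff.mp hb).resolve_right ha)
  rw [Finset.sum_congr rfl fun j _ => key j,
    Fin.sum_univ_eq_sum_range (fun j => (M.starFlag P (j + 1)).jet (M.coef P (j + 1) u) g -
        (M.starFlag P j).jet (M.coef P j u) g),
    Finset.sum_range_sub (fun j => (M.starFlag P j).jet (M.coef P j u) g), coef_last,
    (M.isInteriorStar P).cyclic, sub_self]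

end Surface

/-! ## Signs of gluing data of low degree -/

theorem eval_of_natDegree_le_one {p : ℝ[X]} (hp : p.natDegree ≤ 1) (u : ℝ) :
    p.eval u = p.eval 0 + u * (Polynomial.derivative p).eval 0 := by
  obtain ⟨a, b, rfl⟩ := Polynomial.exists_eq_X_add_C_of_natDegree_le_one hp
  simp
  ring

theorem derivative_eval_of_natDegree_eq_zero {p : ℝ[X]} (hp : p.natDegree = 0) (u : ℝ) :
    (Polynomial.derivative p).eval u = 0 := by
  rw [Polynomial.derivative_of_natDegree_zero hp, Polynomial.eval_zero]

/-- Otherwise the linear polynomial would vanish at −p(0)/p'(0), which would lie in (0, 1]. -/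
theorem neg_one_lt_logDeriv {p : ℝ[X]} (hp : p.natDegree ≤ 1)
    (h : ∀ u ∈ Set.Icc (0 : ℝ) 1, p.eval u ≠ 0) :
    -1 < (Polynomial.derivative p).eval 0 / p.eval 0 := by
  by_contra! hle
  have h0 := h 0 (by simp)
  set d := (Polynomial.derivative p).eval 0 / p.eval 0 with hd
  have hd' : (Polynomial.derivative p).eval 0 = d * p.eval 0 := by
    rw [hd, div_mul_cancel₀ _ h0]
  have hd0 : d < 0 := by linarith
  refine h (-d⁻¹) ⟨by simpa using hd0.le, ?_⟩ ?_
  · rw [← inv_neg]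
    exact inv_le_one_of_one_le₀ (by linarith)
  · rw [eval_of_natDegree_le_one hp, hd', ← mul_assoc, neg_mul, inv_mul_cancel₀ hd0.ne]
    ring

/-- The inequalities for gluing data at a crossing vertex, with a parameter `s`, that allow a
linear dependence between the relations. -/
structure GluingPoly.SignBound (D : GluingPoly) (s : ℝ) : Prop where
  a_pos : 0 < s + (Polynomial.derivative D.a).eval 0 / D.a.eval 0
  c_pos : 0 < s + (Polynomial.derivative D.c).eval 0 / D.c.eval 0
  deriv_beta_nonneg : 0 ≤ deriv D.beta 0

theorem GluingPoly.Regular.c_ne {D : GluingPoly} (h : D.Regular) {u : ℝ}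
    (hu : u ∈ Set.Icc (0 : ℝ) 1) : D.c.eval u ≠ 0 :=
  (h.swap u hu).1

theorem GluingPoly.Regular.c_mul_a_neg {D : GluingPoly} (h : D.Regular) {u : ℝ}
    (hu : u ∈ Set.Icc (0 : ℝ) 1) : D.c.eval u * D.a.eval u < 0 := by
  obtain ⟨ha, hg⟩ := h u hu
  rw [gamma, div_neg_iff] at hg
  rcases hg with hg | hg
  · exact mul_neg_of_pos_of_neg hg.1 hg.2
  · exact mul_neg_of_neg_of_pos hg.1 hg.2

/-- Gluing data of degree zero between triangles is joining at one end-point at most. -/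
theorem GluingPoly.Regular.delta_ne_zero {D : GluingPoly} {s₁ s₂ : Shape} (h : D.Regular)
    (hδ : D.DegreeBound s₁ s₂ 0) (h0 : D.b.eval 0 = 0)
    (h1 : (1 - (s₁.r : ℝ)) * D.a.eval 1 - (1 - (s₂.r : ℝ)) * D.c.eval 1 - D.b.eval 1 = 0) :
    False := by
  have hb : D.b.eval 1 = 0 := by
    rw [eval_of_natDegree_le_one (hδ.b_le.trans zero_le_one), h0,
      derivative_eval_of_natDegree_eq_zero (Nat.le_zero.mp hδ.b_le)]
    simp
  have hs₁ : s₁.r = 0 := by have := hδ.a_le; omega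
  have hs₂ : s₂.r = 0 := by have := hδ.c_le; omega
  rw [hb, hs₁, hs₂] at h1
  have := h.c_mul_a_neg (u := 1) (by simp)
  have e : D.a.eval 1 = D.c.eval 1 := by simpa [sub_eq_zero] using h1
  rw [e] at this
  exact absurd this (not_lt.mpr (mul_self_nonneg _))

/-- Here b is linear with b(0) = 0, so β'(0) = b(1)/a(0). By `h1` this is (1 − r₁) a(1)/a(0) − (1 −
r₂) c(1)/a(0), where a keeps its sign on [0,1] and c has the opposite one. -/
theorem GluingPoly.Regular.signBound_two {D : GluingPoly} {s₁ s₂ : Shape} (h : D.Regular)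
    (hδ : D.DegreeBound s₁ s₂ 1) (h0 : D.b.eval 0 = 0)
    (h1 : (1 - (s₁.r : ℝ)) * D.a.eval 1 - (1 - (s₂.r : ℝ)) * D.c.eval 1 - D.b.eval 1 = 0) :
    D.SignBound 2 := by
  have ha1 : D.a.natDegree ≤ 1 := (Nat.le_add_left _ _).trans hδ.a_le
  have hc1 : D.c.natDegree ≤ 1 := (Nat.le_add_left _ _).trans hδ.c_le
  have ha := neg_one_lt_logDeriv ha1 fun u hu => (h u hu).1
  have hc := neg_one_lt_logDeriv hc1 fun u hu => h.c_ne hu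
  refine ⟨by linarith, by linarith, ?_⟩
  have hb := eval_of_natDegree_le_one hδ.b_le 1
  rw [h0] at hb
  have hr : ∀ s : Shape, 0 ≤ 1 - (s.r : ℝ) := by
    intro s
    cases s <;> simp [Shape.r]
  have hA : 0 ≤ D.a.eval 1 * D.a.eval 0 := by
    rw [eval_of_natDegree_le_one ha1 1]
    have e : (D.a.eval 0 + 1 * (Polynomial.derivative D.a).eval 0) * D.a.eval 0 =
        (1 + (Polynomial.derivative D.a).eval 0 / D.a.eval 0) * D.a.eval 0 ^ 2 := by
      field_simp [h.a_ne]
    rw [e]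
    exact mul_nonneg (by linarith) (sq_nonneg _)
  have hA1 := (h 1 (by simp)).1
  have hC : D.c.eval 1 * D.a.eval 0 ≤ 0 := by
    have h2 := h.c_mul_a_neg (u := 1) (by simp)
    by_contra! h3
    have h4 := mul_nonneg hA h3.le
    have h5 : 0 < D.a.eval 0 ^ 2 := by have := h.a_ne; positivity
    nlinarith
  rw [deriv_beta h.a_ne, h0]
  refine div_nonneg ?_ (sq_nonneg _)
  have e : (Polynomial.derivative D.b).eval 0 * D.a.eval 0 - 0 * (Polynomial.derivative D.a).eval 0 =
      (1 - (s₁.r : ℝ)) * (D.a.eval 1 * D.a.eval 0) -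
        (1 - (s₂.r : ℝ)) * (D.c.eval 1 * D.a.eval 0) := by
    linear_combination (-D.a.eval 0) * hb - D.a.eval 0 * h1
  rw [e]
  nlinarith [mul_nonneg (hr s₁) hA, mul_nonneg (hr s₂) (neg_nonneg.mpr hC)]

theorem GluingPoly.signBound_one {D : GluingPoly} {s₁ s₂ : Shape}
    (hδ : D.DegreeBound s₁ s₂ 0) (h : D.Regular) : D.SignBound 1 := by
  have ha : D.a.natDegree = 0 := by have := hδ.a_le; omega
  have hc : D.c.natDegree = 0 := by have := hδ.c_le; omega
  have hb : D.b.natDegree = 0 := by have := hδ.b_le; omega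
  refine ⟨?_, ?_, ?_⟩
  · rw [derivative_eval_of_natDegree_eq_zero ha]; simp
  · rw [derivative_eval_of_natDegree_eq_zero hc]; simp
  · rw [deriv_beta h.a_ne, derivative_eval_of_natDegree_eq_zero ha,
      derivative_eval_of_natDegree_eq_zero hb]
    simp

namespace Surface

variable {K₀ K₁ : Type*} (M : Surface K₀ K₁)

/-! ## Independence of the relations -/

theorem degreeBound_data (k : K₁) :
    (M.data k).DegreeBound (M.src k).shape (M.tgt k).shape (M.deltaEdge k) :=
  ⟨le_max_left _ _, (le_max_left _ _).trans (le_max_right _ _),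
    (le_max_right _ _).trans (le_max_right _ _)⟩

/-- The space that contains the errors along the glued edges of families of degree at most `k`. -/
def errSpace (k : ℕ) : Submodule ℝ (K₁ → ℝ[X] × ℝ[X]) :=
  Submodule.pi Set.univ fun i =>
    (Polynomial.degreeLT ℝ (k + 1)).prod (Polynomial.degreeLT ℝ (M.deltaEdge i + k))

theorem natDegree_unread_le (e s : Bool) (t : ℝ[X]) :
    (PreSurface.unread e s t).natDegree ≤ t.natDegree := by
  refine (Polynomial.natDegree_smul_le _ _).trans ?_
  cases e
  · exact le_rfl
  · exact (GluingPoly.natDegree_comp_one_sub t).le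

theorem mem_degreeLT_of_natDegree_lt {p : ℝ[X]} {n : ℕ} (h : p.natDegree < n) :
    p ∈ Polynomial.degreeLT ℝ n := by
  rw [Polynomial.mem_degreeLT]
  exact lt_of_le_of_lt Polynomial.degree_le_natDegree (by exact_mod_cast h)

open Classical in
theorem single_mem_errSpace {k : ℕ} {i : K₁} {w : ℝ[X] × ℝ[X]}
    (h1 : w.1 ∈ Polynomial.degreeLT ℝ (k + 1))
    (h2 : w.2 ∈ Polynomial.degreeLT ℝ (M.deltaEdge i + k)) :
    Pi.single i w ∈ M.errSpace k := by
  rw [errSpace, Submodule.mem_pi]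
  intro j _
  by_cases hj : j = i
  · subst hj
    rw [Pi.single_eq_same]
    exact ⟨h1, h2⟩
  · rw [Pi.single_eq_of_ne hj]
    exact zero_mem _

variable {M} {k : ℕ} {u : M.RelParam}

theorem b_eval_of_coef_ne {p : M.Position} (h : (M.coef p.1 (p.2 + 1) u).2 2 ≠ 0) :
    (M.starData p.1 (p.2 + 1)).b.eval 0 = 0 := by
  have hc := M.isCrossing_of_mixedParam_ne (mt (M.coef_mixed_eq_zero_iff p.1 p.2.2 u).mpr h)
  have hj : (p.2 : ℕ) < 4 := p.2.2.trans_eq (M.starLen_of_isCrossing hc)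
  have hb := M.beta_of_isCrossing hc (p.2 + 1) (by simp; omega)
  exact (div_eq_zero_iff.mp hb).resolve_right (M.regular_starData p.1 p.2.2).a_ne

theorem degreeBound_starData (p : M.Position) : ∃ s₁ s₂,
    s₁ = (M.half (M.posEdge p) (M.posEnd p) (M.posSide p)).shape ∧
    s₂ = (M.half (M.posEdge p) (M.posEnd p) !(M.posSide p)).shape ∧
    (M.starData p.1 (p.2 + 1)).DegreeBound s₁ s₂ (M.deltaEdge (M.posEdge p)) := by
  refine ⟨_, _, rfl, rfl, ?_⟩
  rw [starData_succ]
  exact M.degreeBound_halfData _ (M.degreeBound_data _) _ _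

variable [Finite K₀]

/-- An edge has two ends, each in at most one position. The hypothesis `hw` silences the other end.
-/
theorem relation_single_eq [DecidableEq K₁] (p : M.Position) (w : ℝ[X] × ℝ[X])
    (hw : ∀ q : M.Position, M.posEdge q = M.posEdge p → M.posEnd q = (!M.posEnd p) →
      (M.starData q.1 (q.2 + 1)).jetErr (M.coef q.1 (q.2 + 1) u)
        (M.halfErr (M.posEdge p) (!M.posEnd p) (M.posSide q) w) = 0) :
    M.relation u (Pi.single (M.posEdge p) w) =
      (M.starData p.1 (p.2 + 1)).jetErr (M.coef p.1 (p.2 + 1) u)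
        (M.halfErr (M.posEdge p) (M.posEnd p) (M.posSide p) w) := by
  rw [relation_apply, Fintype.sum_eq_single p, Pi.single_eq_same]
  intro q hq
  by_cases hk : M.posEdge q = M.posEdge p
  · have he : M.posEnd q = !M.posEnd p := by
      have : M.posEnd q ≠ M.posEnd p := fun he => hq (M.position_eq hk he)
      revert this
      cases M.posEnd q <;> cases M.posEnd p <;> simp
    have h := hw q hk he
    rw [hk, he, Pi.single_eq_same]
    exact h
  · rw [Pi.single_eq_of_ne hk, map_zero, map_zero]

/-- The condition on the coefficients at a position that follows from a test polynomial for the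
derivative condition. -/
theorem test_eq (hu : ∀ w ∈ M.errSpace k, M.relation u w = 0) (p : M.Position) (t : ℝ[X])
    (ht : t.natDegree < M.deltaEdge (M.posEdge p) + k) (ht1 : t.eval 1 = 0)
    (ht' : (Polynomial.derivative t).eval 1 = 0 ∨
      ∀ q : M.Position, M.posEdge q = M.posEdge p → M.posEnd q = (!M.posEnd p) →
        (M.coef q.1 (q.2 + 1) u).2 2 = 0) :
    (M.coef p.1 (p.2 + 1) u).2 1 * t.eval 0 +
      (M.coef p.1 (p.2 + 1) u).2 2 * ((Polynomial.derivative t).eval 0 -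
        t.eval 0 * ((Polynomial.derivative (M.starData p.1 (p.2 + 1)).a).eval 0 /
          (M.starData p.1 (p.2 + 1)).a.eval 0)) = 0 := by
  classical
  have ha := (M.regular_starData p.1 p.2.2).a_ne
  have hw := hu _ (M.single_mem_errSpace (i := M.posEdge p)
    (w := (0, PreSurface.unread (M.posEnd p) (M.posSide p) t)) (zero_mem _)
    (mem_degreeLT_of_natDegree_lt ((natDegree_unread_le _ _ _).trans_lt ht)))
  rw [relation_single_eq, PreSurface.halfErr_unread, GluingPoly.jetErr_apply] at hw
  · simp only [Polynomial.eval_zero, Polynomial.derivative_zero, mul_zero, zero_add] at hw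
    field_simp at hw ⊢
    linear_combination hw
  · intro q hk he
    obtain ⟨σ, hσ⟩ := M.halfErr_not_unread (M.posEdge p) (M.posEnd p) (M.posSide p)
      (M.posSide q) t
    rw [hσ, GluingPoly.jetErr_apply]
    rcases ht' with ht' | ht'
    · simp [Polynomial.derivative_comp, ht1, ht']
    · simp [ht1, ht' q hk he]

/-- If the mixed derivative occurs in a relation that holds for all errors, then it occurs together
with the transversal derivative in a certain proportion. -/
theorem exists_signBound (hk : 2 ≤ k) (hu : ∀ w ∈ M.errSpace k, M.relation u w = 0)
    (p : M.Position) (hp : (M.coef p.1 (p.2 + 1) u).2 2 ≠ 0) :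
    ∃ s : ℝ, (M.starData p.1 (p.2 + 1)).SignBound s ∧
      (M.coef p.1 (p.2 + 1) u).2 1 = (M.coef p.1 (p.2 + 1) u).2 2 *
        (s + (Polynomial.derivative (M.starData p.1 (p.2 + 1)).a).eval 0 /
          (M.starData p.1 (p.2 + 1)).a.eval 0) := by
  have hreg := M.regular_starData p.1 p.2.2
  have hb := b_eval_of_coef_ne hp
  obtain ⟨s₁, s₂, hs₁, hs₂, hδ⟩ := degreeBound_starData p
  have test := test_eq hu p
  have hX : (1 - Polynomial.X : ℝ[X]).natDegree ≤ 1 :=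
    (Polynomial.natDegree_sub_le _ _).trans (by simp)
  -- If no mixed coefficient is active at the other end, a simple zero there makes a test polynomial
  -- invisible; otherwise a double zero is needed.
  by_cases hq : ∀ q : M.Position, M.posEdge q = M.posEdge p → M.posEnd q = (!M.posEnd p) →
      (M.coef q.1 (q.2 + 1) u).2 2 = 0
  -- X(1 − X) has value 0 and derivative 1 at 0, so it would isolate the mixed coefficient. It must
  -- therefore be too large for the error space. The test 1 − X, with derivative −1, then yields s =
  -- 1.
  · have hsmall : M.deltaEdge (M.posEdge p) + k ≤ 2 := by
      by_contra! hlt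
      have hdeg : (Polynomial.X * (1 - Polynomial.X) : ℝ[X]).natDegree ≤ 2 :=
        Polynomial.natDegree_mul_le_of_le Polynomial.natDegree_X_le hX
      have := test (Polynomial.X * (1 - Polynomial.X)) (hdeg.trans_lt hlt) (by simp) (Or.inr hq)
      simp [hp] at this
    have hδ0 : M.deltaEdge (M.posEdge p) = 0 := by omega
    have h1 := test (1 - Polynomial.X) (hX.trans_lt (by omega)) (by simp) (Or.inr hq)
    rw [hδ0] at hδ
    refine ⟨1, GluingPoly.signBound_one hδ hreg, ?_⟩
    simp at h1
    linear_combination h1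
  · push Not at hq
    obtain ⟨q, hqk, hqe, hq⟩ := hq
    -- An active mixed coefficient at the other end means that the edge is joining there too.
    have hend : (1 - (s₁.r : ℝ)) * (M.starData p.1 (p.2 + 1)).a.eval 1 -
        (1 - (s₂.r : ℝ)) * (M.starData p.1 (p.2 + 1)).c.eval 1 -
        (M.starData p.1 (p.2 + 1)).b.eval 1 = 0 := by
      rw [hs₁, hs₂, starData_succ, ← M.halfData_not_b_eval]
      have h1 := b_eval_of_coef_ne hq
      rw [starData_succ, hqk, hqe] at h1
      by_cases hs : M.posSide q = M.posSide p
      · rwa [hs] at h1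
      · have hs' : M.posSide q = !M.posSide p := by
          revert hs
          cases M.posSide q <;> cases M.posSide p <;> simp
        rw [hs', M.halfData_not_side_b_eval] at h1
        linarith
    have hδ1 : M.deltaEdge (M.posEdge p) ≠ 0 := fun h0 => by
      rw [h0] at hδ
      exact hreg.delta_ne_zero hδ hb hend
    -- The same argument with X(1 − X)² in place of X(1 − X). The test (1 − X)², with derivative −2
    -- at 0, then yields s = 2.
    have hsmall : M.deltaEdge (M.posEdge p) + k ≤ 3 := by
      by_contra! hlt
      have hdeg : (Polynomial.X * (1 - Polynomial.X) ^ 2 : ℝ[X]).natDegree ≤ 1 + 2 * 1 :=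
        Polynomial.natDegree_mul_le_of_le Polynomial.natDegree_X_le
          (Polynomial.natDegree_pow_le_of_le 2 hX)
      have := test (Polynomial.X * (1 - Polynomial.X) ^ 2) (hdeg.trans_lt hlt) (by simp)
        (Or.inl (by simp [Polynomial.derivative_pow]))
      simp [Polynomial.derivative_pow, hp] at this
    have hδ2 : M.deltaEdge (M.posEdge p) = 1 := by omega
    have h2 := test ((1 - Polynomial.X) ^ 2)
      ((Polynomial.natDegree_pow_le_of_le 2 hX).trans_lt (by omega)) (by simp)
      (Or.inl (by simp [Polynomial.derivative_pow]))
    rw [hδ2] at hδ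
    refine ⟨2, hreg.signBound_two hδ hb hend, ?_⟩
    simp [Polynomial.derivative_pow] at h2
    linear_combination h2

/-- Three consecutive edges suffice. The proportions forced on edges 1 and 3 are compared through
the transport across edge 2, and the two sides acquire opposite signs. -/
theorem mixedParam_eq_zero (hk : 2 ≤ k) (hu : ∀ w ∈ M.errSpace k, M.relation u w = 0)
    (P : M.InteriorVertex) : M.mixedParam P u = 0 := by
  by_contra hne
  have hc := M.isCrossing_of_mixedParam_ne hne
  have hlen := M.starLen_of_isCrossing hc
  have hy : ∀ j ≤ 4, (M.coef P j u).2 2 ≠ 0 := fun j hj =>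
    mt (M.coef_mixed_eq_zero_iff P (by omega) u).mp hne
  obtain ⟨s₁, hs₁, e₁⟩ := exists_signBound hk hu ⟨P, ⟨0, by omega⟩⟩ (hy 1 (by omega))
  obtain ⟨s₂, hs₂, -⟩ := exists_signBound hk hu ⟨P, ⟨1, by omega⟩⟩ (hy 2 (by omega))
  obtain ⟨s₃, hs₃, e₃⟩ := exists_signBound hk hu ⟨P, ⟨2, by omega⟩⟩ (hy 3 (by omega))
  have hb₂ := M.beta_of_isCrossing hc 2 (by simp)
  have hg₂ := (M.regular_starData P (j := 1) (by omega)).gamma_neg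
  have hg₃ := (M.regular_starData P (j := 2) (by omega)).gamma_neg
  have ha₃ := (M.regular_starData P (j := 2) (by omega)).a_ne
  have hc₃ := (M.regular_starData P (j := 2) (by omega)).c_ne (u := 0) (by simp)
  have m₂ := M.coef_mixed_step P (j := 1) (by omega) u
  have m₃ := M.coef_mixed_step P (j := 2) (by omega) u
  have q₂ := congrFun (M.coef_step P (j := 1) (by omega) u) 1
  have p₃ := congrFun (M.coef_step P (j := 2) (by omega) u) 0
  simp only [Nat.reduceAdd, zero_add] at *
  simp [Matrix.vecMul, dotProduct, Fin.sum_univ_three, GluingPoly.jetMatrix, hb₂] at q₂ p₃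
  have hγ : deriv (M.starData P 3).gamma 0 = (M.starData P 3).gamma 0 *
      ((Polynomial.derivative (M.starData P 3).c).eval 0 / (M.starData P 3).c.eval 0 -
        (Polynomial.derivative (M.starData P 3).a).eval 0 / (M.starData P 3).a.eval 0) := by
    rw [GluingPoly.deriv_gamma ha₃, GluingPoly.gamma]
    field_simp
  have hp₂ : (M.coef P 2 u).2 0 = (M.coef P 2 u).2 2 *
      (s₃ + (Polynomial.derivative (M.starData P 3).c).eval 0 / (M.starData P 3).c.eval 0) := by
    rw [← p₃, e₃, hγ, m₃]
    ring
  rw [hp₂, e₁, m₂] at q₂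
  -- The left side is positive by `c_pos` and `deriv_beta_nonneg`; the right side is negative since
  -- γ₂(0) < 0.
  have key : s₃ + (Polynomial.derivative (M.starData P 3).c).eval 0 /
      (M.starData P 3).c.eval 0 + deriv (M.starData P 2).beta 0 =
      (M.starData P 2).gamma 0 * (s₁ + (Polynomial.derivative (M.starData P 1).a).eval 0 /
        (M.starData P 1).a.eval 0) := by
    refine mul_left_cancel₀ (hy 2 (by omega)) ?_
    linear_combination q₂
  have h1 := mul_neg_of_neg_of_pos hg₂ hs₁.a_pos
  have h2 := hs₃.c_pos
  have h3 := hs₂.deriv_beta_nonneg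
  linarith

/-- Without mixed coefficients, the test 1 − X kills the coefficient of ∂/∂v at every corner. Since
∂/∂u at one corner is ∂/∂v at the previous one, the coefficient of ∂/∂u dies too. -/
theorem coef_snd_eq_zero (hk : 2 ≤ k) (hu : ∀ w ∈ M.errSpace k, M.relation u w = 0)
    (P : M.InteriorVertex) : (M.initialCoef P u).2 = 0 := by
  have hy : ∀ (Q : M.InteriorVertex) (j : ℕ), j ≤ M.starLen Q → (M.coef Q j u).2 2 = 0 :=
    fun Q j hj => (M.coef_mixed_eq_zero_iff Q hj u).mpr (mixedParam_eq_zero hk hu Q)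
  have hX : (1 - Polynomial.X : ℝ[X]).natDegree ≤ 1 :=
    (Polynomial.natDegree_sub_le _ _).trans (by simp)
  have hq : ∀ j < M.starLen P, (M.coef P (j + 1) u).2 1 = 0 := by
    intro j hj
    have := test_eq hu ⟨P, ⟨j, hj⟩⟩ (1 - Polynomial.X) (hX.trans_lt (by omega)) (by simp)
      (Or.inr fun q _ _ => hy _ _ q.2.2)
    simpa [hy P (j + 1) hj] using this
  have hpos := (M.isInteriorStar P).pos
  have hlast : (M.coef P 0 u).2 1 = 0 := by
    rw [← coef_last]
    have := hq (M.starLen P - 1) (by omega)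
    rwa [Nat.sub_add_cancel hpos] at this
  have h1 := hq 0 hpos
  have h2 := hy P 1 hpos
  have hp := congrFun (M.coef_step P hpos u) 1
  have h0 : (M.coef P 1 u).2 = 0 := by
    rw [hlast] at hp
    simp [Matrix.vecMul, dotProduct, Fin.sum_univ_three, GluingPoly.jetMatrix, h1, h2] at hp
    ext i
    fin_cases i
    · exact hp
    · exact h1
    · exact h2
  have := M.coef_step P hpos u
  rw [zero_add, h0, Matrix.zero_vecMul, coef_zero] at this
  exact this.symm

theorem eq_zero_of_relation_eq_zero (hk : 2 ≤ k)
    (hu : ∀ w ∈ M.errSpace k, M.relation u w = 0) : u = 0 := by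
  classical
  have h0 := coef_snd_eq_zero hk hu
  have hcoef : ∀ (P : M.InteriorVertex) (j : ℕ), (M.coef P j u).2 = 0 := fun P j => by
    rw [coef_snd, h0, Matrix.zero_vecMul]
  -- The test now goes into the value error. Its effect on the second error does not matter, because
  -- all derivative coefficients are already zero.
  have hval : ∀ P : M.InteriorVertex, u (Sum.inl (P, 0)) = 0 := by
    intro P
    let p : M.Position := ⟨P, ⟨0, (M.isInteriorStar P).pos⟩⟩
    have hX : (1 - Polynomial.X : ℝ[X]).natDegree ≤ 1 :=
      (Polynomial.natDegree_sub_le _ _).trans (by simp)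
    have hw := hu _ (M.single_mem_errSpace (i := M.posEdge p)
      (w := (PreSurface.unread (M.posEnd p) (M.posSide p) (1 - Polynomial.X), 0))
      (mem_degreeLT_of_natDegree_lt
        (((natDegree_unread_le _ _ _).trans hX).trans_lt (by omega))) (zero_mem _))
    rw [relation_single_eq, GluingPoly.jetErr_apply, PreSurface.halfErr_unread_fst, hcoef,
      coef_fst] at hw
    · simpa using hw
    · intro q _ _
      obtain ⟨σ, hσ⟩ := M.halfErr_not_unread_fst (M.posEdge p) (M.posEnd p) (M.posSide p)
        (M.posSide q) (1 - Polynomial.X)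
      rw [GluingPoly.jetErr_apply, hσ, hcoef]
      simp
  ext i
  rcases i with ⟨P, i⟩ | ⟨P, hP⟩
  · fin_cases i
    · exact hval P
    · exact congrFun (h0 P) 0
    · exact congrFun (h0 P) 1
  · have := mixedParam_eq_zero hk hu ⟨P, hP.isInterior⟩
    rw [mixedParam, dif_pos hP] at this
    exact this

end Surface

namespace Surface

variable {K₀ K₁ : Type*} (M : Surface K₀ K₁)

/-! ## The dimension bound -/

theorem natDegree_valP_le {k : ℕ} {g : K₀ → MvPolynomial (Fin 2) ℝ} (hg : g ∈ M.degreeLE k)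
    (f : Flag M.Ω) : (f.valP (g f.face)).natDegree ≤ k := by
  have h := M.localExpr_mem_polys hg f
  refine Flag.natDegree_aeval_le _ _ fun s hs _ => ?_
  cases hf : f.shape
  · rw [hf] at h
    have := (MvPolynomial.le_totalDegree hs).trans (Shape.totalDegree_le_of_mem_polys rfl h)
    rw [Finsupp.sum_fintype _ _ (by simp), Fin.sum_univ_two] at this
    omega
  · rw [hf] at h
    exact (MvPolynomial.mem_restrictDegree _ _ _).mp h s hs 0

theorem natDegree_duP_le {k : ℕ} {g : K₀ → MvPolynomial (Fin 2) ℝ} (hg : g ∈ M.degreeLE k)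
    (f : Flag M.Ω) : (f.duP (g f.face)).natDegree ≤ k - 1 := by
  rw [Flag.duP_apply]
  exact (Polynomial.natDegree_derivative_le _).trans
    (Nat.sub_le_sub_right (M.natDegree_valP_le hg f) 1)

theorem natDegree_dvP_le {k : ℕ} (hk : 1 ≤ k) {g : K₀ → MvPolynomial (Fin 2) ℝ}
    (hg : g ∈ M.degreeLE k) (f : Flag M.Ω) :
    (f.dvP (g f.face)).natDegree ≤ k - 1 + f.shape.r := by
  have h := M.localExpr_mem_polys hg f
  refine Flag.natDegree_aeval_pderiv_le _ _ fun s hs hs1 => ?_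
  cases hf : f.shape
  · rw [hf] at h
    have := (MvPolynomial.le_totalDegree hs).trans (Shape.totalDegree_le_of_mem_polys rfl h)
    rw [Finsupp.sum_fintype _ _ (by simp), Fin.sum_univ_two] at this
    omega
  · rw [hf] at h
    have := (MvPolynomial.mem_restrictDegree _ _ _).mp h s hs 0
    simp only [Shape.r]
    omega

/-- A transversal derivative has degree at most k − 1 + r and a tangential one at most k − 1. The
definition of δ is exactly what bounds all three products by δ + k − 1. -/
theorem errMap_mem_errSpace {k : ℕ} (hk : 1 ≤ k) {g : K₀ → MvPolynomial (Fin 2) ℝ}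
    (hg : g ∈ M.degreeLE k) : M.errMap g ∈ M.errSpace k := by
  rw [errSpace, Submodule.mem_pi]
  intro i _
  have hδ := M.degreeBound_data i
  have ha := hδ.a_le
  have hb := hδ.b_le
  have hc := hδ.c_le
  have hv := M.natDegree_dvP_le hk hg (M.src i)
  have hv' := M.natDegree_dvP_le hk hg (M.tgt i)
  have hu := M.natDegree_duP_le hg (M.tgt i)
  refine ⟨mem_degreeLT_of_natDegree_lt (Nat.lt_succ_of_le ?_),
    mem_degreeLT_of_natDegree_lt (lt_of_le_of_lt (b := M.deltaEdge i + (k - 1)) ?_ (by omega))⟩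
  · exact (Polynomial.natDegree_sub_le_of_le (M.natDegree_valP_le hg _)
      (M.natDegree_valP_le hg _)).trans (max_self k).le
  · have h1 := (Polynomial.natDegree_mul_le_of_le (le_refl (M.data i).a.natDegree) hv)
    have h2 := (Polynomial.natDegree_mul_le_of_le (le_refl (M.data i).b.natDegree) hu)
    have h3 := (Polynomial.natDegree_mul_le_of_le (le_refl (M.data i).c.natDegree) hv')
    refine (Polynomial.natDegree_sub_le_of_le (Polynomial.natDegree_sub_le_of_le h1 h2) h3).trans
      (max_le (max_le ?_ ?_) ?_) <;> omega

/-- An element of `errSpace` as a family of pairs of polynomials of bounded degrees. -/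
def errSpaceEmbedding (k : ℕ) : M.errSpace k →ₗ[ℝ]
    ((i : K₁) → Polynomial.degreeLT ℝ (k + 1) × Polynomial.degreeLT ℝ (M.deltaEdge i + k)) where
  toFun w i := (⟨(w.1 i).1, (w.2 i trivial).1⟩, ⟨(w.1 i).2, (w.2 i trivial).2⟩)
  map_add' _ _ := rfl
  map_smul' _ _ := rfl

theorem errSpaceEmbedding_injective (k : ℕ) : Function.Injective (M.errSpaceEmbedding k) := by
  intro w w' h
  ext1
  funext i
  have hi := congrFun h i
  exact Prod.ext (congrArg (fun x => x.1.1) hi) (congrArg (fun x => x.2.1) hi)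

instance [Finite K₁] (k : ℕ) : FiniteDimensional ℝ (M.errSpace k) :=
  Module.Finite.of_injective _ (M.errSpaceEmbedding_injective k)

theorem finrank_errSpace_le [Fintype K₁] (k : ℕ) :
    Module.finrank ℝ (M.errSpace k) ≤ (2 * k + 1) * Fintype.card K₁ + M.delta := by
  refine (LinearMap.finrank_le_finrank_of_injective (M.errSpaceEmbedding_injective k)).trans ?_
  rw [Module.finrank_pi_fintype]
  simp only [Module.finrank_prod, finrank_degreeLT, Finset.sum_add_distrib, delta]
  simp
  linarith

theorem mem_splineSpace_of_errMap_eq_zero {g : K₀ → MvPolynomial (Fin 2) ℝ}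
    (hg : M.errMap g = 0) : g ∈ M.splineSpace := by
  intro i u hu
  have h := congrFun hg i
  have h1 := congrArg (fun e => e.1.eval u) h
  have h2 := congrArg (fun e => e.2.eval u) h
  have ha := M.a_ne_zero i u hu
  simp only [PreSurface.errMap, LinearMap.pi_apply, Flag.err, LinearMap.coe_mk, AddHom.coe_mk,
    Pi.zero_apply, Prod.fst_zero, Prod.snd_zero, Polynomial.eval_zero, Polynomial.eval_sub,
    Polynomial.eval_mul, Flag.eval_valP, Flag.eval_dvP, Flag.eval_duP] at h1 h2
  refine ⟨sub_eq_zero.mp h1, ?_⟩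
  rw [GluingPoly.beta, GluingPoly.gamma]
  field_simp
  linear_combination h2

/-- The errors of families of bounded degree. -/
def errMapLE {k : ℕ} (hk : 1 ≤ k) : M.degreeLE k →ₗ[ℝ] M.errSpace k :=
  (M.errMap.comp (M.degreeLE k).subtype).codRestrict _ fun g => M.errMap_mem_errSpace hk g.2

instance [Finite K₀] (k : ℕ) : FiniteDimensional ℝ (M.splines k) :=
  Submodule.finiteDimensional_of_le (inf_le_right : M.splines k ≤ M.degreeLE k)

theorem finrank_ker_le [Finite K₀] {k : ℕ} (hk : 1 ≤ k) :
    Module.finrank ℝ (LinearMap.ker (M.errMapLE hk)) ≤ Module.finrank ℝ (M.splines k) := by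
  have hmem : ∀ g : LinearMap.ker (M.errMapLE hk), g.1.1 ∈ M.splines k := fun g =>
    ⟨M.mem_splineSpace_of_errMap_eq_zero (congrArg Subtype.val (LinearMap.mem_ker.mp g.2)), g.1.2⟩
  refine LinearMap.finrank_le_finrank_of_injective
    (f := ((M.degreeLE k).subtype ∘ₗ (LinearMap.ker (M.errMapLE hk)).subtype).codRestrict _ hmem) ?_
  intro g g' h
  have h' : g.1.1 = g'.1.1 := congrArg (fun x : M.splines k => x.1) h
  exact Subtype.ext (Subtype.ext h')

theorem finrank_relParam [Finite K₀] : Module.finrank ℝ M.RelParam =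
    3 * Nat.card M.InteriorVertex + M.numCrossing := by
  classical
  have : Fintype {P : M.Vertex // M.IsCrossing P} := Fintype.ofFinite _
  have e : M.numCrossing = Fintype.card {P : M.Vertex // M.IsCrossing P} :=
    Nat.card_eq_fintype_card (α := {P : M.Vertex // M.IsCrossing P})
  rw [Module.finrank_fintype_fun_eq_card, Fintype.card_sum, Fintype.card_prod, e,
    Nat.card_eq_fintype_card, Fintype.card_fin, mul_comm]

theorem finrank_degreeLE_add_le [Fintype K₀] [Fintype K₁] {k : ℕ} (hk : 2 ≤ k) :
    Module.finrank ℝ (M.degreeLE k) + (3 * Nat.card M.InteriorVertex + M.numCrossing) ≤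
      Module.finrank ℝ (M.splines k) + ((2 * k + 1) * Fintype.card K₁ + M.delta) := by
  have hk' : 1 ≤ k := by omega
  have h := finrank_le_finrank_ker (M.errMapLE hk')
    ((M.errSpace k).subtype.dualMap ∘ₗ M.relation)
    (fun u g => M.relation_errMap u g.1)
    (fun u hu => eq_zero_of_relation_eq_zero hk fun w hw => DFunLike.congr_fun hu ⟨w, hw⟩)
  rw [finrank_relParam] at h
  exact h.trans (Nat.add_le_add (M.finrank_ker_le hk') (M.finrank_errSpace_le k))

end Surface

end G1Spline

end

theorem lemma5p4 {K₀ K₁ : Type*} [Fintype K₀] [Fintype K₁] (M : G1Spline.Surface K₀ K₁)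
    (k : ℕ) (hk : 2 ≤ k) :
    FiniteDimensional ℝ (M.splines k) ∧
    3 * (M.numVert : ℝ) + M.numCrossing - M.delta + ((k : ℝ) - 5 / 2) * M.numBoundaryEdge
        + ((k : ℝ) ^ 2 - 2 * k - 1) * M.numRect
        + ((k : ℝ) ^ 2 - 3 * k - 1) / 2 * M.numTri
      ≤ (Module.finrank ℝ (M.splines k) : ℝ) := by
  refine ⟨inferInstance, ?_⟩
  have h1 : (Module.finrank ℝ (M.degreeLE k) : ℝ) +
      (3 * Nat.card M.InteriorVertex + M.numCrossing) ≤
      Module.finrank ℝ (M.splines k) + ((2 * k + 1) * Fintype.card K₁ + M.delta) := by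
    exact_mod_cast M.finrank_degreeLE_add_le hk
  have h2 : (Module.finrank ℝ (M.degreeLE k) : ℝ) * 2 =
      M.numTri * ((k + 1) * (k + 2)) + M.numRect * (2 * (k + 1) ^ 2) := by
    exact_mod_cast M.finrank_degreeLE k
  have h3 : (M.numVert : ℝ) ≤ Nat.card M.InteriorVertex + M.numBoundaryEdge := by
    exact_mod_cast M.card_vertex_le
  have h4 : (M.numTri : ℝ) * 3 + M.numRect * 4 =
      2 * Fintype.card K₁ + M.numBoundaryEdge := by
    exact_mod_cast (M.sum_shape G1Spline.Shape.sides).symm.trans M.card_polyEdge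
  -- The factor 3 trades interior vertices for all vertices minus boundary edges; k + 1/2 is half of
  -- 2k + 1, the edge contribution, since `h4` counts glued edges twice.
  linear_combination h1 - (1 / 2) * h2 + 3 * h3 - (k + 1 / 2 : ℝ) * h4
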